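/- Let $(M,h)$ be a smooth finite-dimensional Hausdorff manifold without boundary, with a smooth pseudo-Riemannian metric $h$ of arbitrary signature (in particular, a Lorentzian spacetime), and let $\nabla$ be its Levi-Civita connection and $R(u,v)w=\nabla_u\nabla_v w-\nabla_v\nabla_u w-\nabla_{[u,v]}w$ its curvature. Assume that $(M,h)$ is geodesically complete, so that the exponential map $\exp_p:T_pM\to M$ is defined on all of $T_pM$ for every $p\in M$. Let $\Sigma$ be a smooth manifold (possibly with boundary or corners), $X:\Sigma\to M$ a smooth map (in particular, the embedding of a submanifold), $\varphi$ a smooth section of $X^*TM$, $\lambda\in\mathbb R$, and \[ \tilde X:\Sigma\to M,\qquad \tilde X(x)=\exp_{X(x)}(\lambda\varphi(x)). \] Let $x\in\Sigma$ and $\xi\in T_x\Sigma$. Then the curve \[ \alpha:[0,1]\to M,\qquad \alpha(s)=\exp_{X(x)}(s\lambda\varphi(x)), \] is a geodesic with $\alpha(0)=X(x)$ and $\alpha'(0)=\lambda\varphi(x)$; there is exactly one Jacobi field $\eta$ along $\alpha$, i.e. exactly one vector field of class $C^2$ along $\alpha$ on $[0,1]$ with $\nabla_s\nabla_s\eta+R(\eta,\alpha')\alpha'=0$,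 that satisfies the initial conditions \[ \eta(0)=\mathrm dX(x)(\xi),\qquad \nabla_s\eta(0)=\lambda\,\nabla_\xi\varphi(x), \] where $\nabla_\xi\varphi$ is the covariant derivative in $M$ of the vector field $\varphi$ along $X$; the map $\tilde X$ is differentiable at $x$; and \[ \mathrm d\tilde X(x)(\xi)=\eta(1). \] -/

import Mathlib

open scoped Manifold ContDiff Topology
open Set Bundle

noncomputable section

namespace PseudoRiem

/-- A smooth pseudo-Riemannian metric (of arbitrary signature, in particular a Lorentzian one) on a
manifold `M` modelled on `E`: a smooth field of symmetric nondegenerate bilinear forms on the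
tangent spaces. -/
structure Metric (E : Type*) [NormedAddCommGroup E] [NormedSpace ℝ E]
    (M : Type*) [TopologicalSpace M] [ChartedSpace E M] [IsManifold 𝓘(ℝ, E) ∞ M] where
  /-- The bilinear form on the tangent space at `p`. -/
  inner (p : M) : TangentSpace 𝓘(ℝ, E) p →L[ℝ] TangentSpace 𝓘(ℝ, E) p →L[ℝ] ℝ
  symm (p : M) (v w : TangentSpace 𝓘(ℝ, E) p) : inner p v w = inner p w v
  nondegenerate (p : M) (v : TangentSpace 𝓘(ℝ, E) p) (hv : ∀ w, inner p v w = 0) : v = 0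
  contMDiff : ContMDiff 𝓘(ℝ, E) (𝓘(ℝ, E).prod 𝓘(ℝ, E →L[ℝ] E →L[ℝ] ℝ)) ∞
    (fun p ↦ TotalSpace.mk' (E →L[ℝ] E →L[ℝ] ℝ) p (inner p))

section

variable {E : Type*} [NormedAddCommGroup E] [NormedSpace ℝ E]
  {M : Type*} [TopologicalSpace M] [ChartedSpace E M] [IsManifold 𝓘(ℝ, E) ∞ M]

/-- The components of the metric in the preferred chart at `q`, at the coordinate point `y : E`:
`g_y(u, v) = h_p(u_p, v_p)`, where `p` is the point with coordinates `y` and `u_p, v_p ∈ T_pM` are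
the tangent vectors with components `u, v` in that chart. -/
def Metric.inChart (h : Metric E M) (q : M) (y : E) : E →L[ℝ] E →L[ℝ] ℝ :=
  let p : M := (extChartAt 𝓘(ℝ, E) q).symm y
  let hp : E →L[ℝ] E →L[ℝ] ℝ := h.inner p
  let toTangent : E →L[ℝ] E := (trivializationAt E (TangentSpace 𝓘(ℝ, E)) q).symmL ℝ p
  hp.bilinearComp toTangent toTangent

/-- The Christoffel symbols of the Levi-Civita connection in the preferred chart at `q`:
`Γ_y(u, v)` is the vector with
`g_y(Γ_y(u, v), w) = (∂_u g_y(v, w) + ∂_v g_y(u, w) - ∂_w g_y(u, v)) / 2` for all `w`. -/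
def Metric.christoffel (h : Metric E M) (q : M) (y u v : E) : E :=
  (h.inChart q y).inverse
    ((1 / 2 : ℝ) • (fderiv ℝ (h.inChart q) y u v + fderiv ℝ (h.inChart q) y v u
      - ((fderiv ℝ (h.inChart q) y).flip u).flip v))

/-- The Riemann curvature tensor `R(u, v)w = ∇_u ∇_v w - ∇_v ∇_u w - ∇_[u,v] w` at `p`, computed in
the preferred chart at `p` (in which `T_pM` is identified with `E` by definition). -/
def Metric.curvature (h : Metric E M) (p : M) (u v w : TangentSpace 𝓘(ℝ, E) p) :
    TangentSpace 𝓘(ℝ, E) p :=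
  let y : E := extChartAt 𝓘(ℝ, E) p p
  let Γ : E → E → E → E := h.christoffel p
  let a : E := u
  let b : E := v
  let c : E := w
  (fderiv ℝ (fun z ↦ Γ z b c) y a - fderiv ℝ (fun z ↦ Γ z a c) y b
    + Γ y a (Γ y b c) - Γ y b (Γ y a c) : E)

section Along

variable {E' : Type*} [NormedAddCommGroup E'] [NormedSpace ℝ E']
  {H' : Type*} [TopologicalSpace H'] (I' : ModelWithCorners ℝ E' H')
  {N : Type*} [TopologicalSpace N] [ChartedSpace H' N]

/-- The covariant derivative `∇_ξ V (x)` of a vector field `V` along a map `f : N → M` (that is,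
`V x ∈ T_{f x}M`) in the direction `ξ ∈ T_xN`, for the Levi-Civita connection of `h`. In the
preferred chart at `f x` it is `∂_ξ V + Γ(df(ξ), V)`. Derivatives are taken within `S ⊆ N`. -/
def Metric.covDerivAlong (h : Metric E M) (f : N → M) (V : ∀ x, TangentSpace 𝓘(ℝ, E) (f x))
    (S : Set N) (x : N) (ξ : TangentSpace I' x) : TangentSpace 𝓘(ℝ, E) (f x) :=
  let components : N → E := fun z ↦
    (trivializationAt E (TangentSpace 𝓘(ℝ, E)) (f x)
      (⟨f z, V z⟩ : TangentBundle 𝓘(ℝ, E) M)).2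
  let dV : E := mfderivWithin I' 𝓘(ℝ, E) components S x ξ
  let df : E := mfderivWithin I' 𝓘(ℝ, E) f S x ξ
  (dV + h.christoffel (f x) (extChartAt 𝓘(ℝ, E) (f x) (f x)) df (V x) : E)

end Along

/-- The velocity `γ'(s)` of a curve in `M` (one-sided at the end points of `S`). -/
def velocity (γ : ℝ → M) (S : Set ℝ) (s : ℝ) : TangentSpace 𝓘(ℝ, E) (γ s) :=
  mfderivWithin 𝓘(ℝ, ℝ) 𝓘(ℝ, E) γ S s (1 : ℝ)

/-- The covariant derivative `∇_s V` of a vector field `V` along a curve `γ`. -/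
def Metric.covDerivCurve (h : Metric E M) (γ : ℝ → M) (S : Set ℝ)
    (V : ∀ s, TangentSpace 𝓘(ℝ, E) (γ s)) (s : ℝ) : TangentSpace 𝓘(ℝ, E) (γ s) :=
  h.covDerivAlong 𝓘(ℝ, ℝ) γ V S s (1 : ℝ)

/-- `γ` is a geodesic on the interval `S`: it is smooth and `∇_s γ' = 0`. -/
structure Metric.IsGeodesicOn (h : Metric E M) (γ : ℝ → M) (S : Set ℝ) : Prop where
  contMDiffOn : ContMDiffOn 𝓘(ℝ, ℝ) 𝓘(ℝ, E) ∞ γ S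
  eq_zero : ∀ s ∈ S, h.covDerivCurve γ S (velocity γ S) s = 0

/-- Geodesic completeness: every `v ∈ T_pM` is the initial velocity of a geodesic defined on all
of `ℝ`. -/
def Metric.IsGeodesicallyComplete (h : Metric E M) : Prop :=
  ∀ v : TangentBundle 𝓘(ℝ, E) M, ∃ γ : ℝ → M, h.IsGeodesicOn γ univ ∧
    (⟨γ 0, velocity γ univ 0⟩ : TangentBundle 𝓘(ℝ, E) M) = v

open Classical in
/-- The exponential map: `exp_p(v) = γ(1)`, where `γ : [0, 1] → M` is the geodesic with `γ(0) = p`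
and `γ'(0) = v` (and the junk value `p` if there is none). -/
def Metric.exp (h : Metric E M) (p : M) (v : TangentSpace 𝓘(ℝ, E) p) : M :=
  if H : ∃ γ : ℝ → M, h.IsGeodesicOn γ (Icc 0 1) ∧
      (⟨γ 0, velocity γ (Icc 0 1) 0⟩ : TangentBundle 𝓘(ℝ, E) M) = ⟨p, v⟩
  then H.choose 1 else p

/-- `η` is a Jacobi field along the curve `α` on the interval `S`: it is a vector field of class
`C^2` along `α` with `∇_s ∇_s η + R(η, α')α' = 0`. -/
structure Metric.IsJacobiFieldOn (h : Metric E M) (α : ℝ → M)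
    (η : ∀ s, TangentSpace 𝓘(ℝ, E) (α s)) (S : Set ℝ) : Prop where
  contMDiffOn : ContMDiffOn 𝓘(ℝ, ℝ) 𝓘(ℝ, E).tangent 2
    (fun s ↦ (⟨α s, η s⟩ : TangentBundle 𝓘(ℝ, E) M)) S
  jacobi_eq : ∀ s ∈ S, h.covDerivCurve α S (h.covDerivCurve α S η) s
    + h.curvature (α s) (η s) (velocity α S s) (velocity α S s) = 0

/-- `η` is a Jacobi field on `[0, 1]` along `α` with initial conditions `η(0) = a` and
`∇_s η(0) = b`, where `a, b ∈ T_pM` and `p = α(0)`. -/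
structure Metric.IsJacobiFieldWithInit (h : Metric E M) (α : ℝ → M)
    (η : ∀ s, TangentSpace 𝓘(ℝ, E) (α s)) (p : M) (a b : TangentSpace 𝓘(ℝ, E) p) : Prop where
  isJacobi : h.IsJacobiFieldOn α η (Icc 0 1)
  init : (⟨α 0, η 0⟩ : TangentBundle 𝓘(ℝ, E) M) = ⟨p, a⟩
  init_deriv : (⟨α 0, h.covDerivCurve α (Icc 0 1) η 0⟩ : TangentBundle 𝓘(ℝ, E) M) = ⟨p, b⟩

/-- The deformed map `X̃(x) = exp_{X(x)}(λ φ(x))`. -/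
def Metric.deform (h : Metric E M) {N : Type*} (X : N → M)
    (φ : ∀ x, TangentSpace 𝓘(ℝ, E) (X x)) (lam : ℝ) (x : N) : M :=
  h.exp (X x) (lam • φ x)

end

end PseudoRiem

end

/-!
The proof works with the geodesic spray on the tangent bundle, the vector field that reads
`(x, v) ↦ (v, -Γ_x(v, v))` in the chart of `TM` over a chart of `M`. A geodesic with its velocity is
an integral curve of the spray (`Metric.IsGeodesicOn.isSprayCurveAt`,
`Metric.isGeodesicOn_of_isSprayCurveAt`), so geodesics are unique (`Metric.IsSprayCurveAt.eqOn`,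
where the Hausdorff property enters), and `exp_p(s v)` is the value at time `s` of the complete
geodesic with initial velocity `v` (`Metric.exp_smul_eq`). That the notions involved do not depend
on the chart rests on the transformation law of the Christoffel symbols
(`christoffelMap_transform`) and, obtained from it by differentiation, the tensoriality of the
curvature (`curvatureMap_transform`).

Let `c y t ∈ TM` be the geodesic with its velocity that starts at `λ φ(y)`. Then `α` and `X'` are
the base points of `c x t` and of `c y 1`, and the candidate for `η(t)` is the derivative of the base
point of `c y t` in the direction `ξ` (`variationField`), so that `dX'(ξ) = η(1)` holds by
construction.

* Differentiability of `y ↦ c y t` at `x` holds at `t = 0`, and the local flow of the spray carries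
  it to all times (`Metric.mdifferentiableAt_variation`). The local flow is differentiable in the
  initial value, and its derivative solves the variational equation
  (`exists_differentiable_localFlow`); hence so does the derivative of `c y t` in the direction `ξ`
  (`Metric.hasDerivAt_variation`).
* In a chart, the variational equation of the spray is the Jacobi equation
  (`hasDerivAt_of_variational`), so `η` is a Jacobi field
  (`Metric.isJacobiFieldOn_variationField`).
* The symmetry of the Christoffel symbols gives `∇_s ∂_ξ = ∇_ξ ∂_s`
  (`Metric.covDerivCurve_variationField`), and at `s = 0` this is the second initial condition.
* A Jacobi field and its covariant derivative solve in each chart, together with the geodesic, a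
  first order system with smooth right-hand side (`jacobiSystem`). This yields the uniqueness of
  Jacobi fields (`Metric.IsJacobiFieldOn.eqOn`) and the smoothness of `η`.
-/

namespace PseudoRiem

-- Needed for the normed structure of iterated spaces of continuous linear maps.
set_option maxSynthPendingDepth 3

/-! ### Ordinary differential equations -/

section ODE

variable {W : Type*} [NormedAddCommGroup W] [NormedSpace ℝ W]

/-- Two-sided Grönwall inequality for a curve that vanishes at time `0`. The factor in front of the
perturbation `e` is a constant that does not depend on the curve. -/
lemma norm_le_mul_gronwallBound {f f' : ℝ → W} {K e ε t : ℝ}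
    (hf : ∀ s ∈ Ioo (-ε) ε, HasDerivAt f (f' s) s) (h0 : f 0 = 0)
    (hb : ∀ s ∈ Ioo (-ε) ε, ‖f' s‖ ≤ K * ‖f s‖ + e) (ht : t ∈ Ioo (-ε) ε) :
    ‖f t‖ ≤ e * gronwallBound 0 K 1 |t| := by
  have scale : ∀ x, gronwallBound 0 K e x = e * gronwallBound 0 K 1 x := by
    intro x
    unfold gronwallBound
    split_ifs <;> ring
  rw [← scale]
  rcases le_total 0 t with h | h
  · have hsub : Icc 0 t ⊆ Ioo (-ε) ε := fun s hs ↦ ⟨by linarith [ht.1, ht.2, hs.1],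
      by linarith [ht.2, hs.2]⟩
    have := norm_le_gronwallBound_of_norm_deriv_right_le (f := f) (f' := f') (δ := 0) (K := K)
      (ε := e) (a := 0) (b := t)
      (fun s hs ↦ (hf s (hsub hs)).continuousAt.continuousWithinAt)
      (fun s hs ↦ (hf s (hsub (Ico_subset_Icc_self hs))).hasDerivWithinAt) (by simp [h0])
      (fun s hs ↦ hb s (hsub (Ico_subset_Icc_self hs))) t ⟨h, le_rfl⟩
    simpa [abs_of_nonneg h] using this
  · have hsub : ∀ s ∈ Icc 0 (-t), -s ∈ Ioo (-ε) ε := fun s hs ↦ ⟨by linarith [ht.1, hs.2],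
      by linarith [ht.1, ht.2, hs.1]⟩
    have hd : ∀ s ∈ Icc 0 (-t), HasDerivAt (fun s ↦ f (-s)) (-f' (-s)) s := fun s hs ↦ by
      simpa [Function.comp_def] using (hf (-s) (hsub s hs)).scomp s (hasDerivAt_neg s)
    have := norm_le_gronwallBound_of_norm_deriv_right_le (f := fun s ↦ f (-s))
      (f' := fun s ↦ -f' (-s)) (δ := 0) (K := K)
      (ε := e) (a := 0) (b := -t)
      (fun s hs ↦ (hd s hs).continuousAt.continuousWithinAt)
      (fun s hs ↦ (hd s (Ico_subset_Icc_self hs)).hasDerivWithinAt) (by simp [h0])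
      (fun s hs ↦ by simpa using hb (-s) (hsub s (Ico_subset_Icc_self hs))) (-t)
      ⟨by linarith, le_rfl⟩
    simpa [abs_of_nonpos h] using this

/-- Uniqueness of solutions of a differential equation on an arbitrary interval `S`, where the
derivatives are taken within `S`. -/
lemma eqOn_of_hasDerivWithinAt {S : Set ℝ} [hS : S.OrdConnected] {v : ℝ → W → W} {K : NNReal}
    {D : Set W} (hv : ∀ t ∈ S, LipschitzOnWith K (v t) D) {f g : ℝ → W}
    (hf : ∀ t ∈ S, HasDerivWithinAt f (v t (f t)) S t) (hfD : ∀ t ∈ S, f t ∈ D)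
    (hg : ∀ t ∈ S, HasDerivWithinAt g (v t (g t)) S t) (hgD : ∀ t ∈ S, g t ∈ D)
    {t₀ : ℝ} (ht₀ : t₀ ∈ S) (h : f t₀ = g t₀) : EqOn f g S := by
  have right : ∀ u : ℝ → W, (∀ t ∈ S, HasDerivWithinAt u (v t (u t)) S t) → ∀ a ∈ S, ∀ b ∈ S,
      ∀ t ∈ Ico a b, HasDerivWithinAt u (v t (u t)) (Ici t) t := by
    intro u hu a ha b hb t ht
    have hsub : Icc t b ⊆ S := hS.out (hS.out ha hb (Ico_subset_Icc_self ht)) hb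
    exact ((hu t (hsub ⟨le_rfl, ht.2.le⟩)).mono hsub).mono_of_mem_nhdsWithin
      (Icc_mem_nhdsGE ht.2)
  have left : ∀ u : ℝ → W, (∀ t ∈ S, HasDerivWithinAt u (v t (u t)) S t) → ∀ a ∈ S, ∀ b ∈ S,
      ∀ t ∈ Ioc a b, HasDerivWithinAt u (v t (u t)) (Iic t) t := by
    intro u hu a ha b hb t ht
    have hsub : Icc a t ⊆ S := hS.out ha (hS.out ha hb (Ioc_subset_Icc_self ht))
    exact ((hu t (hsub ⟨ht.1.le, le_rfl⟩)).mono hsub).mono_of_mem_nhdsWithin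
      (Icc_mem_nhdsLE ht.1)
  have cont : ∀ u : ℝ → W, (∀ t ∈ S, HasDerivWithinAt u (v t (u t)) S t) → ContinuousOn u S :=
    fun u hu t ht ↦ (hu t ht).continuousWithinAt
  intro t ht
  rcases le_total t₀ t with h' | h'
  · have hsub := hS.out ht₀ ht
    exact ODE_solution_unique_of_mem_Icc_right (s := fun _ ↦ D)
      (fun s hs ↦ hv s (hsub (Ico_subset_Icc_self hs)))
      ((cont f hf).mono hsub) (right f hf t₀ ht₀ t ht)
      (fun s hs ↦ hfD s (hsub (Ico_subset_Icc_self hs)))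
      ((cont g hg).mono hsub) (right g hg t₀ ht₀ t ht)
      (fun s hs ↦ hgD s (hsub (Ico_subset_Icc_self hs))) h ⟨h', le_rfl⟩
  · have hsub := hS.out ht ht₀
    exact ODE_solution_unique_of_mem_Icc_left (s := fun _ ↦ D)
      (fun s hs ↦ hv s (hsub (Ioc_subset_Icc_self hs)))
      ((cont f hf).mono hsub) (left f hf t ht t₀ ht₀)
      (fun s hs ↦ hfD s (hsub (Ioc_subset_Icc_self hs)))
      ((cont g hg).mono hsub) (left g hg t ht t₀ ht₀)
      (fun s hs ↦ hgD s (hsub (Ioc_subset_Icc_self hs))) h ⟨le_rfl, h'⟩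

/-- A solution of an autonomous differential equation with smooth right-hand side is smooth. -/
lemma contDiffAt_of_hasDerivAt [CompleteSpace W] {F : W → W} {U : Set W} (hF : ContDiffOn ℝ ∞ F U)
    {f : ℝ → W} {t₀ : ℝ} (hf : ∀ᶠ t in 𝓝 t₀, f t ∈ U ∧ HasDerivAt f (F (f t)) t) :
    ContDiffAt ℝ ∞ f t₀ := by
  obtain ⟨ε, hε, h⟩ := Metric.eventually_nhds_iff_ball.1 hf
  have hsub : Icc (t₀ - ε / 2) (t₀ + ε / 2) ⊆ Metric.ball t₀ ε := by
    rw [Real.ball_eq_Ioo]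
    intro s hs
    exact ⟨by linarith [hs.1], by linarith [hs.2]⟩
  have := ODE.contDiffOn_enat_Icc_of_hasDerivWithinAt (f := fun _ ↦ F) (n := ⊤) (u := U)
    (tmin := t₀ - ε / 2) (tmax := t₀ + ε / 2) (α := f)
    (hF.comp contDiff_snd.contDiffOn fun p hp ↦ hp.2)
    (fun t ht ↦ (h t (hsub ht)).2.hasDerivWithinAt) (fun t ht ↦ (h t (hsub ht)).1)
  exact this.contDiffAt (Icc_mem_nhds (by linarith) (by linarith))

/-- Local flow of a smooth vector field: it exists for a time that is uniform in the initial value,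
is differentiable in the initial value, and its derivative solves the variational equation
`ζ' = DF(Φ) ζ`. -/
theorem exists_differentiable_localFlow [CompleteSpace W] {F : W → W} {U : Set W} (hU : IsOpen U)
    (hF : ContDiffOn ℝ ∞ F U) {w₀ : W} (hw₀ : w₀ ∈ U) :
    ∃ r > 0, ∃ ε > 0, ∃ Φ : W → ℝ → W, ∃ L : W → ℝ → W →L[ℝ] W, ∀ w ∈ Metric.ball w₀ r,
      Φ w 0 = w ∧ L w 0 = .id ℝ W ∧ ∀ t ∈ Ioo (-ε) ε,
        Φ w t ∈ U ∧ HasDerivAt (Φ w) (F (Φ w t)) t ∧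
        HasFDerivAt (fun w' ↦ Φ w' t) (L w t) w ∧
        HasDerivAt (L w) ((fderiv ℝ F (Φ w t)).comp (L w t)) t := by
  -- A ball around `w₀` on which `F` has a bounded and Lipschitz derivative.
  have hFd : ContDiffOn ℝ ∞ (fderiv ℝ F) U := hF.fderiv_of_isOpen hU (by simp)
  obtain ⟨C, s, hs, hC⟩ := ((hFd.contDiffAt (hU.mem_nhds hw₀)).of_le
    (show (1 : WithTop ℕ∞) ≤ ∞ by norm_cast)).exists_lipschitzOnWith
  obtain ⟨ρ, hρ, hρs⟩ : ∃ ρ > 0, Metric.ball w₀ ρ ⊆ s ∩ U :=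
    Metric.mem_nhds_iff.1 (Filter.inter_mem hs (hU.mem_nhds hw₀))
  -- The flow and its derivative are found together as a flow of the extended field.
  let G : W × (W →L[ℝ] W) → W × (W →L[ℝ] W) := fun p ↦ (F p.1, (fderiv ℝ F p.1).comp p.2)
  have hG : ContDiffAt ℝ 1 G (w₀, .id ℝ W) := by
    have h1 : ContDiffAt ℝ ∞ (fun p : W × (W →L[ℝ] W) ↦ F p.1) (w₀, .id ℝ W) :=
      ContDiffAt.comp (g := F) _ (hF.contDiffAt (hU.mem_nhds hw₀)) contDiffAt_fst
    have h2 : ContDiffAt ℝ ∞ (fun p : W × (W →L[ℝ] W) ↦ fderiv ℝ F p.1) (w₀, .id ℝ W) :=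
      ContDiffAt.comp (g := fderiv ℝ F) _ (hFd.contDiffAt (hU.mem_nhds hw₀)) contDiffAt_fst
    exact (h1.prodMk (h2.clm_comp contDiffAt_snd)).of_le (by norm_cast)
  obtain ⟨ε, hε, a, r, L, K, hr, hpl⟩ := IsPicardLindelof.of_contDiffAt_one hG
  obtain ⟨α, hα, L', hL'⟩ :=
    (hpl 0).exists_forall_mem_closedBall_eq_hasDerivWithinAt_lipschitzOnWith
  have hcont : ContinuousOn (Function.uncurry α)
      (Metric.closedBall (w₀, .id ℝ W) r ×ˢ Icc (0 - ε) (0 + ε)) := by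
    apply continuousOn_prod_of_continuousOn_lipschitzOnWith _ L' _ hL'
    exact fun x hx ↦ HasDerivWithinAt.continuousOn (hα x hx).2
  simp only [zero_sub, zero_add] at hα hL' hcont
  -- Shrink the domain so that the flow stays in the ball.
  have hmem : Metric.closedBall ((w₀, .id ℝ W) : W × (W →L[ℝ] W)) r ×ˢ Icc (-ε) ε ∈
      𝓝 (((w₀, .id ℝ W) : W × (W →L[ℝ] W)), (0 : ℝ)) :=
    prod_mem_nhds (Metric.closedBall_mem_nhds _ (by exact_mod_cast hr))
      (Icc_mem_nhds (by linarith) hε)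
  have hα0 : α (w₀, .id ℝ W) 0 = (w₀, .id ℝ W) :=
    (hα _ (Metric.mem_closedBall_self (by positivity))).1
  have hnear : ∀ᶠ p in 𝓝 (((w₀, .id ℝ W) : W × (W →L[ℝ] W)), (0 : ℝ)),
      (Function.uncurry α p).1 ∈ Metric.ball w₀ ρ := by
    refine (hcont.continuousAt hmem).fst.eventually_mem (Metric.isOpen_ball.mem_nhds ?_)
    simpa [Function.uncurry, hα0] using hρ
  obtain ⟨r', hr', hball⟩ := Metric.eventually_nhds_iff_ball.1 hnear
  have hr2 : (0 : ℝ) < min (r : ℝ) r' := lt_min (by exact_mod_cast hr) hr'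
  have hε2 : 0 < min ε r' := lt_min hε hr'
  refine ⟨min (r : ℝ) r', hr2, min ε r', hε2, fun w t ↦ (α (w, .id ℝ W) t).1,
    fun w t ↦ (α (w, .id ℝ W) t).2, ?_⟩
  have hin : ∀ w ∈ Metric.ball w₀ (min (r : ℝ) r'),
      ((w, .id ℝ W) : W × (W →L[ℝ] W)) ∈ Metric.closedBall (w₀, .id ℝ W) r := by
    intro w hw
    rw [Metric.mem_closedBall, Prod.dist_eq, dist_self, max_eq_left dist_nonneg]
    exact (hw.trans_le (min_le_left _ _)).le
  have hstay : ∀ w ∈ Metric.ball w₀ (min (r : ℝ) r'), ∀ t ∈ Ioo (-min ε r') (min ε r'),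
      (α (w, .id ℝ W) t).1 ∈ Metric.ball w₀ ρ := by
    intro w hw t ht
    refine hball ((w, .id ℝ W), t) ?_
    rw [Metric.mem_ball, Prod.dist_eq, Prod.dist_eq, dist_self, max_eq_left dist_nonneg]
    refine max_lt (hw.trans_le (min_le_right _ _)) ?_
    rw [Real.dist_eq, sub_zero, abs_lt]
    exact ⟨by linarith [ht.1, min_le_right ε r'], by linarith [ht.2, min_le_right ε r']⟩
  have htime : ∀ t ∈ Ioo (-min ε r') (min ε r'), t ∈ Ioo (-ε) ε := fun t ht ↦
    ⟨by linarith [ht.1, min_le_left ε r'], by linarith [ht.2, min_le_left ε r']⟩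
  have hder : ∀ w ∈ Metric.ball w₀ (min (r : ℝ) r'), ∀ t ∈ Ioo (-min ε r') (min ε r'),
      HasDerivAt (α (w, .id ℝ W)) (G (α (w, .id ℝ W) t)) t := by
    intro w hw t ht
    have ht' := htime t ht
    exact ((hα _ (hin w hw)).2 t (Ioo_subset_Icc_self ht')).hasDerivAt
      (Icc_mem_nhds ht'.1 ht'.2)
  intro w hw
  refine ⟨by simp [(hα _ (hin w hw)).1], by simp [(hα _ (hin w hw)).1], fun t ht ↦
    ⟨(hρs (hstay w hw t ht)).2, (hder w hw t ht).fst, ?_, (hder w hw t ht).snd⟩⟩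
  -- Differentiability in the initial value.
  obtain ⟨B, hB⟩ : ∃ B, ∀ z ∈ Metric.ball w₀ ρ, ‖fderiv ℝ F z‖ ≤ B := by
    refine ⟨C * ρ + ‖fderiv ℝ F w₀‖, fun z hz ↦ ?_⟩
    have h1 := hC.dist_le_mul z (hρs hz).1 w₀ (hρs (Metric.mem_ball_self hρ)).1
    have h2 : (C : ℝ) * dist z w₀ ≤ C * ρ := by gcongr; exact (Metric.mem_ball.1 hz).le
    have h3 := norm_le_norm_sub_add (fderiv ℝ F z) (fderiv ℝ F w₀)
    rw [dist_eq_norm] at h1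
    linarith
  have hquad : ∀ w' ∈ Metric.ball w₀ (min (r : ℝ) r'),
      ‖(α (w', .id ℝ W) t).1 - (α (w, .id ℝ W) t).1 - (α (w, .id ℝ W) t).2 (w' - w)‖ ≤
        C * (L' * ‖w' - w‖) ^ 2 * gronwallBound 0 B 1 |t| := by
    intro w' hw'
    refine norm_le_mul_gronwallBound (ε := min ε r') (K := B)
      (f := fun t ↦ (α (w', .id ℝ W) t).1 - (α (w, .id ℝ W) t).1 - (α (w, .id ℝ W) t).2 (w' - w))
      (f' := fun t ↦ F (α (w', .id ℝ W) t).1 - F (α (w, .id ℝ W) t).1 -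
        ((fderiv ℝ F (α (w, .id ℝ W) t).1).comp (α (w, .id ℝ W) t).2) (w' - w))
      ?_ ?_ ?_ ht
    · intro s hs
      have h1 : HasDerivAt (fun t ↦ (α (w, .id ℝ W) t).2)
          ((fderiv ℝ F (α (w, .id ℝ W) s).1).comp (α (w, .id ℝ W) s).2) s := (hder w hw s hs).snd
      have h2 := h1.clm_apply (hasDerivAt_const s (w' - w))
      rw [map_zero, add_zero] at h2
      exact (HasDerivAt.sub (hder w' hw' s hs).fst (hder w hw s hs).fst).sub h2
    · simp [(hα _ (hin w hw)).1, (hα _ (hin w' hw')).1]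
    · intro s hs
      set z := (α (w, .id ℝ W) s).1 with hz
      set z' := (α (w', .id ℝ W) s).1 with hz'
      set A := (α (w, .id ℝ W) s).2 with hA
      have hzm := hstay w hw s hs
      have hzm' := hstay w' hw' s hs
      rw [← hz] at hzm
      rw [← hz'] at hzm'
      have hlip : ‖z' - z‖ ≤ L' * ‖w' - w‖ := by
        have h1 := (hL' s (Ioo_subset_Icc_self (htime s hs))).dist_le_mul _ (hin w' hw') _
          (hin w hw)
        rw [Prod.dist_eq, Prod.dist_eq, dist_self, max_eq_left dist_nonneg] at h1
        rw [← dist_eq_norm, ← dist_eq_norm]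
        exact (le_max_left _ _).trans h1
      have htaylor : ‖F z' - F z - fderiv ℝ F z (z' - z)‖ ≤ (C * ‖z' - z‖) * ‖z' - z‖ := by
        have hseg : segment ℝ z z' ⊆ Metric.ball w₀ ρ := (convex_ball w₀ ρ).segment_subset hzm hzm'
        refine (convex_segment z z').norm_image_sub_le_of_norm_hasFDerivWithin_le'
          (f' := fderiv ℝ F) (fun y hy ↦ ?_) (fun y hy ↦ ?_) (left_mem_segment ℝ z z')
          (right_mem_segment ℝ z z')
        · exact ((hF.contDiffAt (hU.mem_nhds (hρs (hseg hy)).2)).differentiableAt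
            (by simp)).hasFDerivAt.hasFDerivWithinAt
        · have h1 := hC.dist_le_mul y (hρs (hseg hy)).1 z (hρs hzm).1
          rw [dist_eq_norm, dist_eq_norm] at h1
          refine h1.trans ?_
          gcongr
          exact norm_sub_le_of_mem_segment hy
      have hsplit : F z' - F z - ((fderiv ℝ F z).comp A) (w' - w) =
          fderiv ℝ F z (z' - z - A (w' - w)) + (F z' - F z - fderiv ℝ F z (z' - z)) := by
        simp only [map_sub, ContinuousLinearMap.comp_apply]
        abel
      rw [hsplit]
      refine (norm_add_le _ _).trans (add_le_add ?_ (htaylor.trans ?_))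
      · exact ((fderiv ℝ F z).le_opNorm _).trans (by gcongr; exact hB z hzm)
      · calc C * ‖z' - z‖ * ‖z' - z‖ = C * ‖z' - z‖ ^ 2 := by ring
          _ ≤ _ := by gcongr
  rw [hasFDerivAt_iff_isLittleO]
  have hO : (fun w' ↦ (α (w', .id ℝ W) t).1 - (α (w, .id ℝ W) t).1 -
      (α (w, .id ℝ W) t).2 (w' - w)) =O[𝓝 w] fun w' ↦ ‖w' - w‖ ^ 2 := by
    refine Asymptotics.IsBigO.of_bound (C * L' ^ 2 * gronwallBound 0 B 1 |t|) ?_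
    filter_upwards [Metric.isOpen_ball.mem_nhds hw] with w' hw'
    refine (hquad w' hw').trans_eq ?_
    rw [norm_pow, norm_norm]
    ring
  refine hO.trans_isLittleO ?_
  have h2 : (fun w' ↦ ‖w' - w‖ ^ 2) =o[𝓝 w] fun w' ↦ ‖w' - w‖ ^ 1 := by
    have : Filter.Tendsto (fun w' ↦ ‖w' - w‖) (𝓝 w) (𝓝 0) := by
      have : Continuous fun w' ↦ ‖w' - w‖ := by fun_prop
      simpa using this.tendsto w
    exact (Asymptotics.isLittleO_pow_pow (by norm_num : 1 < 2)).comp_tendsto this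
  simpa using h2

end ODE

/-! ### Christoffel symbols and curvature in a vector space -/

section Coordinates

variable {E : Type*} [NormedAddCommGroup E] [NormedSpace ℝ E]

/-- The Koszul expression `(∂_u g(v, w) + ∂_v g(u, w) - ∂_w g(u, v)) / 2`, as a trilinear function of
`u, v, w` that depends linearly on the derivative `D` of `g`. -/
noncomputable def koszul : (E →L[ℝ] E →L[ℝ] E →L[ℝ] ℝ) →L[ℝ] E →L[ℝ] E →L[ℝ] E →L[ℝ] ℝ :=
  let flip₁ := (ContinuousLinearMap.flipₗᵢ ℝ E E (E →L[ℝ] ℝ)).toContinuousLinearEquiv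
  let flip₂ := (ContinuousLinearMap.flipₗᵢ ℝ E E ℝ).toContinuousLinearEquiv
  (1 / 2 : ℝ) • (.id ℝ (E →L[ℝ] E →L[ℝ] E →L[ℝ] ℝ) + flip₁.toContinuousLinearMap -
    (ContinuousLinearMap.compL ℝ E (E →L[ℝ] E →L[ℝ] ℝ) (E →L[ℝ] E →L[ℝ] ℝ)
      flip₂.toContinuousLinearMap).comp flip₁.toContinuousLinearMap)

lemma koszul_apply (D : E →L[ℝ] E →L[ℝ] E →L[ℝ] ℝ) (u v : E) :
    koszul D u v = (1 / 2 : ℝ) • (D u v + D v u - (D.flip u).flip v) :=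
  rfl

/-- The Christoffel symbols of a field `g` of bilinear forms, as a field of bilinear maps. -/
noncomputable def christoffelMap (g : E → E →L[ℝ] E →L[ℝ] ℝ) (y : E) : E →L[ℝ] E →L[ℝ] E :=
  (ContinuousLinearMap.compL ℝ E (E →L[ℝ] ℝ) E (g y).inverse).comp (koszul (fderiv ℝ g y))

lemma christoffelMap_apply (g : E → E →L[ℝ] E →L[ℝ] ℝ) (y u v : E) :
    christoffelMap g y u v = (g y).inverse
      ((1 / 2 : ℝ) • (fderiv ℝ g y u v + fderiv ℝ g y v u - ((fderiv ℝ g y).flip u).flip v)) := by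
  rw [← koszul_apply]
  rfl

lemma isInvertible_of_nondegenerate [FiniteDimensional ℝ E] {b : E →L[ℝ] E →L[ℝ] ℝ}
    (hb : ∀ v, (∀ w, b v w = 0) → v = 0) : b.IsInvertible := by
  have hinj : Function.Injective (b : E →ₗ[ℝ] E →L[ℝ] ℝ) := by
    rw [← LinearMap.ker_eq_bot, LinearMap.ker_eq_bot']
    exact fun v hv ↦ hb v fun w ↦ by simpa using DFunLike.congr_fun hv w
  have hdim : Module.finrank ℝ E = Module.finrank ℝ (E →L[ℝ] ℝ) := by
    rw [← (LinearMap.toContinuousLinearMap (𝕜 := ℝ) (E := E) (F' := ℝ)).finrank_eq]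
    exact (Subspace.dual_finrank_eq (K := ℝ) (V := E)).symm
  refine ⟨(LinearMap.linearEquivOfInjective _ hinj hdim).toContinuousLinearEquiv, ?_⟩
  ext v w
  simp

lemma christoffelMap_spec {g : E → E →L[ℝ] E →L[ℝ] ℝ} {y : E} (hg : (g y).IsInvertible)
    (u v w : E) : g y (christoffelMap g y u v) w =
      (fderiv ℝ g y u v w + fderiv ℝ g y v u w - fderiv ℝ g y w u v) / 2 := by
  rw [christoffelMap_apply, hg.self_apply_inverse]
  simp
  ring

lemma christoffelMap_symm {g : E → E →L[ℝ] E →L[ℝ] ℝ} {y : E} (hg : DifferentiableAt ℝ g y)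
    (hs : ∀ᶠ z in 𝓝 y, ∀ u v, g z u v = g z v u) (u v : E) :
    christoffelMap g y u v = christoffelMap g y v u := by
  have key : ∀ w, fderiv ℝ g y w u v = fderiv ℝ g y w v u := by
    intro w
    have h1 : ∀ a b : E, HasFDerivAt (fun z ↦ g z a b) (((fderiv ℝ g y).flip a).flip b) y := by
      intro a b
      simpa [ContinuousLinearMap.ext_iff] using
        (hg.hasFDerivAt.clm_apply (hasFDerivAt_const a y)).clm_apply (hasFDerivAt_const b y)
    have h2 := (h1 u v).congr_of_eventuallyEq (hs.mono fun z hz ↦ (hz u v).symm)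
    simpa using DFunLike.congr_fun (h2.unique (h1 v u)) w
  rw [christoffelMap_apply, christoffelMap_apply]
  congr 2
  ext w
  simp [key]
  ring

lemma contDiffOn_christoffelMap [FiniteDimensional ℝ E] {g : E → E →L[ℝ] E →L[ℝ] ℝ} {U : Set E}
    (hU : IsOpen U) (hg : ContDiffOn ℝ ∞ g U) (hinv : ∀ y ∈ U, (g y).IsInvertible) :
    ContDiffOn ℝ ∞ (christoffelMap g) U := by
  have : CompleteSpace E := FiniteDimensional.complete ℝ E
  have h1 : ContDiffOn ℝ ∞ (fderiv ℝ g) U := hg.fderiv_of_isOpen hU (by simp)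
  have h2 : ContDiffOn ℝ ∞ (fun y ↦ (g y).inverse) U := by
    intro y hy
    obtain ⟨e, he⟩ := hinv y hy
    have := contDiffAt_map_inverse (n := ∞) (𝕜 := ℝ) e
    rw [he] at this
    exact this.comp_contDiffWithinAt y (hg y hy)
  have h3 := (ContinuousLinearMap.compL ℝ E (E →L[ℝ] ℝ) E).contDiff (n := ∞).comp_contDiffOn h2
  exact h3.clm_comp ((koszul (E := E)).contDiff.comp_contDiffOn h1)

/-- Transformation law of the Christoffel symbols under a change of coordinates `ψ`: it contains
the second derivative of `ψ`. -/
theorem christoffelMap_transform {g g' : E → E →L[ℝ] E →L[ℝ] ℝ} {ψ : E → E} {y : E}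
    (hψ : ContDiffAt ℝ 2 ψ y) (hg : DifferentiableAt ℝ g y) (hg' : DifferentiableAt ℝ g' (ψ y))
    (hgg : ∀ᶠ z in 𝓝 y, ∀ u v, g z u v = g' (ψ z) (fderiv ℝ ψ z u) (fderiv ℝ ψ z v))
    (hs : ∀ u v, g' (ψ y) u v = g' (ψ y) v u) (hi : (g y).IsInvertible)
    (hi' : (g' (ψ y)).IsInvertible) (hsurj : Function.Surjective (fderiv ℝ ψ y)) (u v : E) :
    christoffelMap g' (ψ y) (fderiv ℝ ψ y u) (fderiv ℝ ψ y v) =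
      fderiv ℝ ψ y (christoffelMap g y u v) - fderiv ℝ (fderiv ℝ ψ) y u v := by
  have hψ1 : HasFDerivAt ψ (fderiv ℝ ψ y) y :=
    (hψ.differentiableAt (by norm_num)).hasFDerivAt
  have hψ2 : HasFDerivAt (fderiv ℝ ψ) (fderiv ℝ (fderiv ℝ ψ) y) y :=
    ((hψ.fderiv_right (m := 1) (by norm_num)).differentiableAt (by norm_num)).hasFDerivAt
  have hsym : ∀ a b, fderiv ℝ (fderiv ℝ ψ) y a b = fderiv ℝ (fderiv ℝ ψ) y b a :=
    fun a b ↦ (hψ.isSymmSndFDerivAt (by simp)).eq a b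
  have key : ∀ a b c, fderiv ℝ g y a b c =
      fderiv ℝ g' (ψ y) (fderiv ℝ ψ y a) (fderiv ℝ ψ y b) (fderiv ℝ ψ y c) +
      g' (ψ y) (fderiv ℝ (fderiv ℝ ψ) y a b) (fderiv ℝ ψ y c) +
      g' (ψ y) (fderiv ℝ ψ y b) (fderiv ℝ (fderiv ℝ ψ) y a c) := by
    intro a b c
    have h1 := (hg.hasFDerivAt.clm_apply (hasFDerivAt_const b y)).clm_apply (hasFDerivAt_const c y)
    have h2 := ((HasFDerivAt.comp y hg'.hasFDerivAt hψ1).clm_apply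
      (hψ2.clm_apply (hasFDerivAt_const b y))).clm_apply (hψ2.clm_apply (hasFDerivAt_const c y))
    have h3 := h2.congr_of_eventuallyEq (hgg.mono fun z hz ↦ hz b c)
    have h4 := DFunLike.congr_fun (h1.unique h3) a
    simp at h4
    linarith
  refine hi'.injective ?_
  ext w'
  obtain ⟨w, rfl⟩ := hsurj w'
  rw [christoffelMap_spec hi', map_sub, sub_apply]
  have hb : ∀ b c d, g y b c = d → g' (ψ y) (fderiv ℝ ψ y b) (fderiv ℝ ψ y c) = d :=
    fun b c d h ↦ by rw [← h, hgg.self_of_nhds]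
  rw [hb _ _ _ (christoffelMap_spec hi u v w), key u v w, key v u w, key w u v,
    hsym v u, hsym w u, hsym w v, hs _ (fderiv ℝ ψ y v)]
  ring

/-- The curvature of the connection with Christoffel symbols `Γ`. -/
noncomputable def curvatureMap (Γ : E → E →L[ℝ] E →L[ℝ] E) (y a b c : E) : E :=
  fderiv ℝ Γ y a b c - fderiv ℝ Γ y b a c + Γ y a (Γ y b c) - Γ y b (Γ y a c)

/-- The curvature is a tensor: this follows from the transformation law of the Christoffel symbols
by one more differentiation and antisymmetrization. -/
theorem curvatureMap_transform {Γ Γ' : E → E →L[ℝ] E →L[ℝ] E} {ψ : E → E} {y : E}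
    (hψ : ContDiffAt ℝ 3 ψ y) (hΓ : DifferentiableAt ℝ Γ y) (hΓ' : DifferentiableAt ℝ Γ' (ψ y))
    (h : ∀ᶠ z in 𝓝 y, ∀ u v, Γ' (ψ z) (fderiv ℝ ψ z u) (fderiv ℝ ψ z v) =
      fderiv ℝ ψ z (Γ z u v) - fderiv ℝ (fderiv ℝ ψ) z u v) (a b c : E) :
    curvatureMap Γ' (ψ y) (fderiv ℝ ψ y a) (fderiv ℝ ψ y b) (fderiv ℝ ψ y c) =
      fderiv ℝ ψ y (curvatureMap Γ y a b c) := by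
  have hψ1 : HasFDerivAt ψ (fderiv ℝ ψ y) y :=
    (hψ.differentiableAt (by norm_num)).hasFDerivAt
  have hcd : ContDiffAt ℝ 2 (fderiv ℝ ψ) y := hψ.fderiv_right (by norm_num)
  have hψ2 : HasFDerivAt (fderiv ℝ ψ) (fderiv ℝ (fderiv ℝ ψ) y) y :=
    (hcd.differentiableAt (by norm_num)).hasFDerivAt
  have hψ3 : HasFDerivAt (fderiv ℝ (fderiv ℝ ψ)) (fderiv ℝ (fderiv ℝ (fderiv ℝ ψ)) y) y :=
    ((hcd.fderiv_right (m := 1) (by norm_num)).differentiableAt (by norm_num)).hasFDerivAt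
  have hsym : ∀ a b, fderiv ℝ (fderiv ℝ ψ) y a b = fderiv ℝ (fderiv ℝ ψ) y b a :=
    fun a b ↦ ((hψ.of_le (by norm_num : (2 : WithTop ℕ∞) ≤ 3)).isSymmSndFDerivAt (by simp)).eq a b
  have hsym3 : ∀ a b, fderiv ℝ (fderiv ℝ (fderiv ℝ ψ)) y a b =
      fderiv ℝ (fderiv ℝ (fderiv ℝ ψ)) y b a :=
    fun a b ↦ (hcd.isSymmSndFDerivAt (by simp)).eq a b
  have key : ∀ a b c, fderiv ℝ Γ' (ψ y) (fderiv ℝ ψ y a) (fderiv ℝ ψ y b) (fderiv ℝ ψ y c) +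
      Γ' (ψ y) (fderiv ℝ (fderiv ℝ ψ) y a b) (fderiv ℝ ψ y c) +
      Γ' (ψ y) (fderiv ℝ ψ y b) (fderiv ℝ (fderiv ℝ ψ) y a c) =
      fderiv ℝ (fderiv ℝ ψ) y a (Γ y b c) + fderiv ℝ ψ y (fderiv ℝ Γ y a b c) -
        fderiv ℝ (fderiv ℝ (fderiv ℝ ψ)) y a b c := by
    intro a b c
    have h1 := ((HasFDerivAt.comp y hΓ'.hasFDerivAt hψ1).clm_apply
      (hψ2.clm_apply (hasFDerivAt_const b y))).clm_apply (hψ2.clm_apply (hasFDerivAt_const c y))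
    have h2 := (hψ2.clm_apply ((hΓ.hasFDerivAt.clm_apply (hasFDerivAt_const b y)).clm_apply
      (hasFDerivAt_const c y))).sub
      ((hψ3.clm_apply (hasFDerivAt_const b y)).clm_apply (hasFDerivAt_const c y))
    have h3 := h2.congr_of_eventuallyEq (h.mono fun z hz ↦ hz b c)
    have h4 := DFunLike.congr_fun (h1.unique h3) a
    simp at h4
    rw [add_assoc, add_comm (fderiv ℝ (fderiv ℝ ψ) y a (Γ y b c)), ← h4]
    abel
  have h0 : ∀ u v, Γ' (ψ y) (fderiv ℝ ψ y u) (fderiv ℝ ψ y v) =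
      fderiv ℝ ψ y (Γ y u v) - fderiv ℝ (fderiv ℝ ψ) y u v := h.self_of_nhds
  have e1 := key a b c
  have e2 := key b a c
  rw [hsym b a, hsym3 b a] at e2
  have e3 : ∀ a b, Γ' (ψ y) (fderiv ℝ ψ y a) (Γ' (ψ y) (fderiv ℝ ψ y b) (fderiv ℝ ψ y c)) =
      fderiv ℝ ψ y (Γ y a (Γ y b c)) - fderiv ℝ (fderiv ℝ ψ) y a (Γ y b c) -
      Γ' (ψ y) (fderiv ℝ ψ y a) (fderiv ℝ (fderiv ℝ ψ) y b c) := by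
    intro a b
    rw [h0 b c, map_sub, h0]
  unfold curvatureMap
  rw [e3 a b, e3 b a, map_sub, map_add, map_sub]
  rw [← sub_eq_zero] at e1 e2 ⊢
  rw [← sub_zero (_ - _ : E), ← sub_self (0 : E)]
  nth_rewrite 1 [← e1]
  rw [← e2]
  abel

/-- The geodesic spray: the vector field `(x, v) ↦ (v, -Γ_x(v, v))`, whose integral curves are the
geodesics together with their velocities. -/
noncomputable def spray (Γ : E → E →L[ℝ] E →L[ℝ] E) (p : E × E) : E × E :=
  (p.2, -Γ p.1 p.2 p.2)

lemma contDiffOn_spray {Γ : E → E →L[ℝ] E →L[ℝ] E} {U : Set E} (hΓ : ContDiffOn ℝ ∞ Γ U) :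
    ContDiffOn ℝ ∞ (spray Γ) (U ×ˢ univ) := by
  have h1 : ContDiffOn ℝ ∞ (fun p : E × E ↦ Γ p.1) (U ×ˢ univ) :=
    hΓ.comp contDiff_fst.contDiffOn fun p hp ↦ hp.1
  exact contDiff_snd.contDiffOn.prodMk
    ((h1.clm_apply contDiff_snd.contDiffOn).clm_apply contDiff_snd.contDiffOn).neg

lemma fderiv_spray {Γ : E → E →L[ℝ] E →L[ℝ] E} {p : E × E} (hΓ : DifferentiableAt ℝ Γ p.1)
    (q : E × E) : fderiv ℝ (spray Γ) p q =
      (q.2, -(fderiv ℝ Γ p.1 q.1 p.2 p.2 + Γ p.1 q.2 p.2 + Γ p.1 p.2 q.2)) := by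
  have h1 : HasFDerivAt (fun p : E × E ↦ Γ p.1) _ p :=
    HasFDerivAt.comp p hΓ.hasFDerivAt hasFDerivAt_fst
  have h2 := (hasFDerivAt_snd (𝕜 := ℝ) (p := p)).prodMk
    ((h1.clm_apply hasFDerivAt_snd).clm_apply hasFDerivAt_snd).neg
  have h3 : HasFDerivAt (spray Γ) _ p := h2
  rw [h3.fderiv]
  simp
  abel

/-- The derivative of the spray along a geodesic is the Jacobi operator: if `(u, w)` solves the
variational equation along the geodesic `x` with velocity `v`, then `w + Γ(v, u)` is the covariant
derivative of `u`, and the covariant derivative of that is `-R(u, v)v`. -/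
theorem hasDerivAt_of_variational {Γ : E → E →L[ℝ] E →L[ℝ] E} {z ζ : ℝ → E × E} {t : ℝ}
    (hΓ : DifferentiableAt ℝ Γ (z t).1) (hs : ∀ᶠ y in 𝓝 (z t).1, ∀ u v, Γ y u v = Γ y v u)
    (hz : HasDerivAt z (spray Γ (z t)) t) (hζ : HasDerivAt ζ (fderiv ℝ (spray Γ) (z t) (ζ t)) t) :
    HasDerivAt (fun s ↦ (ζ s).2 + Γ (z s).1 (z s).2 (ζ s).1)
      (-curvatureMap Γ (z t).1 (ζ t).1 (z t).2 (z t).2 -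
        Γ (z t).1 (z t).2 ((ζ t).2 + Γ (z t).1 (z t).2 (ζ t).1)) t := by
  rw [fderiv_spray hΓ] at hζ
  have hx : HasDerivAt (fun s ↦ (z s).1) (z t).2 t := hz.fst
  have hv : HasDerivAt (fun s ↦ (z s).2) (-Γ (z t).1 (z t).2 (z t).2) t := hz.snd
  have hu : HasDerivAt (fun s ↦ (ζ s).1) (ζ t).2 t := hζ.fst
  have hw : HasDerivAt (fun s ↦ (ζ s).2) _ t := hζ.snd
  have h1 : HasDerivAt (fun s ↦ Γ (z s).1) (fderiv ℝ Γ (z t).1 (z t).2) t :=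
    hΓ.hasFDerivAt.comp_hasDerivAt t hx
  refine (hw.add ((h1.clm_apply hv).clm_apply hu)).congr_deriv ?_
  simp only [curvatureMap, map_add, map_neg, add_apply,
    neg_apply]
  have hs0 := hs.self_of_nhds
  have hs1 : ∀ a b c, fderiv ℝ Γ (z t).1 c a b = fderiv ℝ Γ (z t).1 c b a := by
    intro a b c
    have h2 : ∀ a b : E, HasFDerivAt (fun y ↦ Γ y a b)
        (((fderiv ℝ Γ (z t).1).flip a).flip b) (z t).1 := by
      intro a b
      simpa [ContinuousLinearMap.ext_iff] using
        (hΓ.hasFDerivAt.clm_apply (hasFDerivAt_const a _)).clm_apply (hasFDerivAt_const b _)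
    have h3 := (h2 a b).congr_of_eventuallyEq (hs.mono fun y hy ↦ (hy a b).symm)
    simpa using DFunLike.congr_fun (h3.unique (h2 b a)) c
  rw [hs0 (ζ t).2 (z t).2, hs0 (Γ (z t).1 (z t).2 (z t).2) (ζ t).1, hs1 (z t).2 (ζ t).1,
    hs0 (ζ t).1 (z t).2]
  abel

end Coordinates

/-! ### Christoffel symbols and curvature in the charts of a manifold -/

section Charts

variable {E : Type*} [NormedAddCommGroup E] [NormedSpace ℝ E]
  {M : Type*} [TopologicalSpace M] [ChartedSpace E M]

/-- To verify a property of coordinate points near the coordinates of `b`, it suffices to verify it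
for points of the manifold near `b`. -/
lemma eventually_coord {p b : M} (hp : b ∈ (extChartAt 𝓘(ℝ, E) p).source) {P : E → Prop}
    (h : ∀ᶠ b' in 𝓝 b, P (extChartAt 𝓘(ℝ, E) p b')) :
    ∀ᶠ y in 𝓝 (extChartAt 𝓘(ℝ, E) p b), P y := by
  have h1 := continuousAt_extChartAt_symm' (I := 𝓘(ℝ, E)) hp
  rw [ContinuousAt, (extChartAt 𝓘(ℝ, E) p).left_inv hp] at h1
  filter_upwards [h1.eventually h, (isOpen_extChartAt_target (I := 𝓘(ℝ, E)) p).mem_nhds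
    ((extChartAt 𝓘(ℝ, E) p).map_source hp)] with y hy hy'
  rwa [(extChartAt 𝓘(ℝ, E) p).right_inv hy'] at hy

variable (E) in
/-- The change of coordinates from the preferred chart at `p` to the preferred chart at `q`. -/
noncomputable abbrev transition (p q : M) : E → E :=
  extChartAt 𝓘(ℝ, E) q ∘ (extChartAt 𝓘(ℝ, E) p).symm

lemma transition_apply {p q b : M} (hp : b ∈ (extChartAt 𝓘(ℝ, E) p).source) :
    transition E p q (extChartAt 𝓘(ℝ, E) p b) = extChartAt 𝓘(ℝ, E) q b := by
  rw [transition, Function.comp_apply, (extChartAt 𝓘(ℝ, E) p).left_inv hp]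

variable [IsManifold 𝓘(ℝ, E) ∞ M]

lemma tangentCoordChange_eq_fderiv (p q b : M) : tangentCoordChange 𝓘(ℝ, E) p q b =
    fderiv ℝ (transition E p q) (extChartAt 𝓘(ℝ, E) p b) := by
  rw [tangentCoordChange_def]
  simp [transition]

lemma contDiffAt_transition {p q b : M} (hp : b ∈ (extChartAt 𝓘(ℝ, E) p).source)
    (hq : b ∈ (extChartAt 𝓘(ℝ, E) q).source) :
    ContDiffAt ℝ ∞ (transition E p q) (extChartAt 𝓘(ℝ, E) p b) := by
  have := contDiffWithinAt_ext_coord_change (I := 𝓘(ℝ, E)) (n := ∞) q p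
    (y := extChartAt 𝓘(ℝ, E) p b) (by
      rw [PartialEquiv.trans_source]
      exact ⟨(extChartAt 𝓘(ℝ, E) p).map_source hp, by
        rwa [mem_preimage, (extChartAt 𝓘(ℝ, E) p).left_inv hp]⟩)
  rwa [modelWithCornersSelf_coe, range_id, contDiffWithinAt_univ] at this

lemma tangentCoordChange_inverse {p q b : M} (hp : b ∈ (extChartAt 𝓘(ℝ, E) p).source)
    (hq : b ∈ (extChartAt 𝓘(ℝ, E) q).source) (v : E) :
    tangentCoordChange 𝓘(ℝ, E) q p b (tangentCoordChange 𝓘(ℝ, E) p q b v) = v := by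
  rw [tangentCoordChange_comp ⟨⟨hp, hq⟩, hp⟩, tangentCoordChange_self hp]

lemma tangentCoordChange_injective {p q b : M} (hp : b ∈ (extChartAt 𝓘(ℝ, E) p).source)
    (hq : b ∈ (extChartAt 𝓘(ℝ, E) q).source) :
    Function.Injective (tangentCoordChange 𝓘(ℝ, E) p q b) :=
  Function.LeftInverse.injective (tangentCoordChange_inverse hp hq)

lemma tangentCoordChange_surjective {p q b : M} (hp : b ∈ (extChartAt 𝓘(ℝ, E) p).source)
    (hq : b ∈ (extChartAt 𝓘(ℝ, E) q).source) :
    Function.Surjective (tangentCoordChange 𝓘(ℝ, E) p q b) :=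
  Function.RightInverse.surjective (tangentCoordChange_inverse hq hp)

variable (h : Metric E M)

lemma Metric.inChart_apply {q b : M} (hq : b ∈ (extChartAt 𝓘(ℝ, E) q).source) (u v : E) :
    h.inChart q (extChartAt 𝓘(ℝ, E) q b) u v =
      h.inner b (tangentCoordChange 𝓘(ℝ, E) q b b u) (tangentCoordChange 𝓘(ℝ, E) q b b v) := by
  unfold Metric.inChart
  dsimp only
  rw [(extChartAt 𝓘(ℝ, E) q).left_inv hq, TangentBundle.symmL_trivializationAt_eq_core
    (by rwa [extChartAt_source] at hq)]
  rfl

lemma Metric.inChart_symm {q b : M} (hq : b ∈ (extChartAt 𝓘(ℝ, E) q).source) (u v : E) :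
    h.inChart q (extChartAt 𝓘(ℝ, E) q b) u v = h.inChart q (extChartAt 𝓘(ℝ, E) q b) v u := by
  rw [h.inChart_apply hq, h.inChart_apply hq]
  exact h.symm b _ _

lemma Metric.inChart_isInvertible [FiniteDimensional ℝ E] {q b : M}
    (hq : b ∈ (extChartAt 𝓘(ℝ, E) q).source) :
    (h.inChart q (extChartAt 𝓘(ℝ, E) q b)).IsInvertible := by
  refine isInvertible_of_nondegenerate fun v hv ↦ ?_
  have h1 : tangentCoordChange 𝓘(ℝ, E) q b b v = 0 := by
    refine h.nondegenerate b _ fun w ↦ ?_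
    obtain ⟨w', rfl⟩ := tangentCoordChange_surjective hq (mem_extChartAt_source (I := 𝓘(ℝ, E)) b) w
    exact (h.inChart_apply hq v w').symm.trans (hv w')
  exact tangentCoordChange_injective hq (mem_extChartAt_source b) (h1.trans (map_zero _).symm)

lemma Metric.inChart_transition {p q b : M} (hp : b ∈ (extChartAt 𝓘(ℝ, E) p).source)
    (hq : b ∈ (extChartAt 𝓘(ℝ, E) q).source) (u v : E) :
    h.inChart p (extChartAt 𝓘(ℝ, E) p b) u v = h.inChart q (extChartAt 𝓘(ℝ, E) q b)
      (tangentCoordChange 𝓘(ℝ, E) p q b u) (tangentCoordChange 𝓘(ℝ, E) p q b v) := by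
  rw [h.inChart_apply hp, h.inChart_apply hq,
    tangentCoordChange_comp ⟨⟨hp, hq⟩, mem_extChartAt_source b⟩,
    tangentCoordChange_comp ⟨⟨hp, hq⟩, mem_extChartAt_source b⟩]

lemma Metric.contDiffOn_inChart [FiniteDimensional ℝ E] (q : M) :
    ContDiffOn ℝ ∞ (h.inChart q) (extChartAt 𝓘(ℝ, E) q).target := by
  rw [contDiffOn_clm_apply]
  intro u
  rw [contDiffOn_clm_apply]
  intro v
  have hsec : ∀ w : E, ContMDiffOn 𝓘(ℝ, E) 𝓘(ℝ, E).tangent ∞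
      (fun p ↦ (⟨p, (trivializationAt E (TangentSpace 𝓘(ℝ, E)) q).symmL ℝ p w⟩ :
        TangentBundle 𝓘(ℝ, E) M)) (trivializationAt E (TangentSpace 𝓘(ℝ, E)) q).baseSet := by
    intro w
    refine (Bundle.Trivialization.contMDiffOn_section_baseSet_iff
      (e := trivializationAt E (TangentSpace 𝓘(ℝ, E)) q)
      (s := fun p ↦ (trivializationAt E (TangentSpace 𝓘(ℝ, E)) q).symmL ℝ p w)).2 ?_
    refine (contMDiffOn_const (c := w)).congr fun p hp ↦ ?_
    rw [Trivialization.symmL_apply, Trivialization.apply_mk_symm _ hp]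
    exact hp
  have hin : ContMDiffOn 𝓘(ℝ, E) (𝓘(ℝ, E).prod 𝓘(ℝ)) ∞
      (fun p ↦ TotalSpace.mk' ℝ (E := Bundle.Trivial M ℝ) p
        (h.inner p ((trivializationAt E (TangentSpace 𝓘(ℝ, E)) q).symmL ℝ p u)
          ((trivializationAt E (TangentSpace 𝓘(ℝ, E)) q).symmL ℝ p v)))
      (trivializationAt E (TangentSpace 𝓘(ℝ, E)) q).baseSet := by
    apply ContMDiffOn.clm_bundle_apply₂ (F₁ := E) (F₂ := E)
    · exact h.contMDiff.contMDiffOn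
    · exact hsec u
    · exact hsec v
  have hfun : ContMDiffOn 𝓘(ℝ, E) 𝓘(ℝ) ∞
      (fun p ↦ h.inner p ((trivializationAt E (TangentSpace 𝓘(ℝ, E)) q).symmL ℝ p u)
          ((trivializationAt E (TangentSpace 𝓘(ℝ, E)) q).symmL ℝ p v))
      (trivializationAt E (TangentSpace 𝓘(ℝ, E)) q).baseSet := by
    intro p hp
    have := hin p hp
    simp only [contMDiffWithinAt_totalSpace] at this
    exact this.2
  rw [← contMDiffOn_iff_contDiffOn]
  refine hfun.comp (contMDiffOn_extChartAt_symm q) fun y hy ↦ ?_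
  have := (extChartAt 𝓘(ℝ, E) q).map_target hy
  rwa [extChartAt_source] at this

/-- The Christoffel symbols in the preferred chart at `q`, as a field of bilinear maps. -/
noncomputable abbrev Metric.christoffelAt (q : M) : E → E →L[ℝ] E →L[ℝ] E :=
  christoffelMap (h.inChart q)

lemma Metric.christoffel_eq (q : M) (y u v : E) :
    h.christoffel q y u v = h.christoffelAt q y u v := by
  rw [christoffelMap_apply]
  rfl

section FiniteDimensional

variable [FiniteDimensional ℝ E]

lemma Metric.contDiffOn_christoffelAt (q : M) :
    ContDiffOn ℝ ∞ (h.christoffelAt q) (extChartAt 𝓘(ℝ, E) q).target := by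
  refine contDiffOn_christoffelMap (isOpen_extChartAt_target q) (h.contDiffOn_inChart q)
    fun y hy ↦ ?_
  rw [← (extChartAt 𝓘(ℝ, E) q).right_inv hy]
  exact h.inChart_isInvertible ((extChartAt 𝓘(ℝ, E) q).map_target hy)

lemma Metric.differentiableAt_christoffelAt {q b : M}
    (hq : b ∈ (extChartAt 𝓘(ℝ, E) q).source) :
    DifferentiableAt ℝ (h.christoffelAt q) (extChartAt 𝓘(ℝ, E) q b) :=
  ((h.contDiffOn_christoffelAt q).contDiffAt ((isOpen_extChartAt_target q).mem_nhds
    ((extChartAt 𝓘(ℝ, E) q).map_source hq))).differentiableAt (by simp)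

lemma Metric.differentiableAt_inChart {q b : M}
    (hq : b ∈ (extChartAt 𝓘(ℝ, E) q).source) :
    DifferentiableAt ℝ (h.inChart q) (extChartAt 𝓘(ℝ, E) q b) :=
  ((h.contDiffOn_inChart q).contDiffAt ((isOpen_extChartAt_target q).mem_nhds
    ((extChartAt 𝓘(ℝ, E) q).map_source hq))).differentiableAt (by simp)

lemma Metric.christoffelAt_symm {q b : M} (hq : b ∈ (extChartAt 𝓘(ℝ, E) q).source) :
    ∀ᶠ y in 𝓝 (extChartAt 𝓘(ℝ, E) q b), ∀ u v,
      h.christoffelAt q y u v = h.christoffelAt q y v u := by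
  refine eventually_coord hq ?_
  filter_upwards [extChartAt_source_mem_nhds' (I := 𝓘(ℝ, E)) hq] with b' hb'
  refine christoffelMap_symm (h.differentiableAt_inChart hb') (eventually_coord hb' ?_)
  filter_upwards [extChartAt_source_mem_nhds' (I := 𝓘(ℝ, E)) hb'] with b'' hb''
  exact h.inChart_symm hb''

lemma Metric.christoffelAt_transition {p q b : M} (hp : b ∈ (extChartAt 𝓘(ℝ, E) p).source)
    (hq : b ∈ (extChartAt 𝓘(ℝ, E) q).source) (u v : E) :
    h.christoffelAt q (extChartAt 𝓘(ℝ, E) q b) (tangentCoordChange 𝓘(ℝ, E) p q b u)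
        (tangentCoordChange 𝓘(ℝ, E) p q b v) =
      tangentCoordChange 𝓘(ℝ, E) p q b (h.christoffelAt p (extChartAt 𝓘(ℝ, E) p b) u v) -
        fderiv ℝ (fderiv ℝ (transition E p q)) (extChartAt 𝓘(ℝ, E) p b) u v := by
  rw [tangentCoordChange_eq_fderiv, ← transition_apply (q := q) hp]
  refine christoffelMap_transform ((contDiffAt_transition hp hq).of_le (by norm_cast))
    (h.differentiableAt_inChart hp) ?_ (eventually_coord hp ?_) ?_ (h.inChart_isInvertible hp) ?_ ?_
    u v
  · rw [transition_apply hp]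
    exact h.differentiableAt_inChart hq
  · filter_upwards [extChartAt_source_mem_nhds' (I := 𝓘(ℝ, E)) hp,
      extChartAt_source_mem_nhds' (I := 𝓘(ℝ, E)) hq] with b' hp' hq' u v
    rw [h.inChart_transition hp' hq', transition_apply hp', tangentCoordChange_eq_fderiv]
  · rw [transition_apply hp]
    exact h.inChart_symm hq
  · rw [transition_apply hp]
    exact h.inChart_isInvertible hq
  · rw [← tangentCoordChange_eq_fderiv]
    exact tangentCoordChange_surjective hp hq

lemma Metric.curvature_eq (p : M) (u v w : E) :
    h.curvature p u v w = curvatureMap (h.christoffelAt p) (extChartAt 𝓘(ℝ, E) p p) u v w := by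
  have hd := (h.differentiableAt_christoffelAt (mem_extChartAt_source (I := 𝓘(ℝ, E)) p)).hasFDerivAt
  have key : ∀ a b : E, fderiv ℝ (fun z ↦ h.christoffelAt p z a b) (extChartAt 𝓘(ℝ, E) p p) =
      ((fderiv ℝ (h.christoffelAt p) (extChartAt 𝓘(ℝ, E) p p)).flip a).flip b := by
    intro a b
    refine HasFDerivAt.fderiv ?_
    simpa [ContinuousLinearMap.ext_iff] using
      (hd.clm_apply (hasFDerivAt_const a _)).clm_apply (hasFDerivAt_const b _)
  unfold Metric.curvature curvatureMap
  simp only [h.christoffel_eq, key, ContinuousLinearMap.flip_apply]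
  rfl

/-- The curvature tensor computed in the preferred chart at `q` instead of the preferred chart at
the point. -/
lemma Metric.tangentCoordChange_curvature {q b : M} (hq : b ∈ (extChartAt 𝓘(ℝ, E) q).source)
    (u v w : E) : tangentCoordChange 𝓘(ℝ, E) b q b (h.curvature b u v w) =
      curvatureMap (h.christoffelAt q) (extChartAt 𝓘(ℝ, E) q b)
        (tangentCoordChange 𝓘(ℝ, E) b q b u) (tangentCoordChange 𝓘(ℝ, E) b q b v)
        (tangentCoordChange 𝓘(ℝ, E) b q b w) := by
  have hb := mem_extChartAt_source (I := 𝓘(ℝ, E)) b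
  rw [h.curvature_eq, tangentCoordChange_eq_fderiv, ← transition_apply (q := q) hb]
  symm
  refine curvatureMap_transform ((contDiffAt_transition hb hq).of_le (by norm_cast))
    (h.differentiableAt_christoffelAt hb) ?_ (eventually_coord hb ?_) u v w
  · rw [transition_apply hb]
    exact h.differentiableAt_christoffelAt hq
  · filter_upwards [extChartAt_source_mem_nhds' (I := 𝓘(ℝ, E)) hb,
      extChartAt_source_mem_nhds' (I := 𝓘(ℝ, E)) hq] with b' hb' hq' u v
    rw [transition_apply hb', ← tangentCoordChange_eq_fderiv]
    exact h.christoffelAt_transition hb' hq' u v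

end FiniteDimensional

end Charts

/-! ### Curves in the tangent bundle in coordinates -/

/-- The derivative of the components of a vector along a curve after a change of coordinates. -/
lemma hasDerivWithinAt_fderiv_apply {E F : Type*} [NormedAddCommGroup E] [NormedSpace ℝ E]
    [NormedAddCommGroup F] [NormedSpace ℝ F] {f : E → F} {x u : ℝ → E} {a b : E} {S : Set ℝ} {s : ℝ}
    (hf : ContDiffAt ℝ 2 f (x s)) (hx : HasDerivWithinAt x a S s) (hu : HasDerivWithinAt u b S s) :
    HasDerivWithinAt (fun t ↦ fderiv ℝ f (x t) (u t))
      (fderiv ℝ (fderiv ℝ f) (x s) a (u s) + fderiv ℝ f (x s) b) S s := by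
  have hD := ((hf.fderiv_right (m := 1) (by norm_num)).differentiableAt (by norm_num)).hasFDerivAt
  exact (hD.comp_hasDerivWithinAt s hx).clm_apply hu

section TangentChart

variable {E : Type*} [NormedAddCommGroup E] [NormedSpace ℝ E]
  {M : Type*} [TopologicalSpace M] [ChartedSpace E M] [IsManifold 𝓘(ℝ, E) ∞ M]

/-- The components of a tangent vector at `p` in the preferred chart at `q`. -/
noncomputable def vecCoord (q : M) {p : M} (v : TangentSpace 𝓘(ℝ, E) p) : E :=
  tangentCoordChange 𝓘(ℝ, E) p q p v

lemma vecCoord_self {p : M} (v : TangentSpace 𝓘(ℝ, E) p) : vecCoord p v = (v : E) :=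
  tangentCoordChange_self (mem_extChartAt_source p)

lemma tangentCoordChange_vecCoord {q r p : M} (hq : p ∈ (extChartAt 𝓘(ℝ, E) q).source)
    (hr : p ∈ (extChartAt 𝓘(ℝ, E) r).source) (v : TangentSpace 𝓘(ℝ, E) p) :
    tangentCoordChange 𝓘(ℝ, E) q r p (vecCoord q v) = vecCoord r v :=
  tangentCoordChange_comp ⟨⟨mem_extChartAt_source p, hq⟩, hr⟩

lemma vecCoord_injective {q p : M} (hq : p ∈ (extChartAt 𝓘(ℝ, E) q).source) :
    Function.Injective (vecCoord (E := E) q (p := p)) := by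
  intro v w hvw
  have h1 := tangentCoordChange_injective (E := E) (mem_extChartAt_source p) hq
  exact h1 hvw

lemma Metric.vecCoord_curvature [FiniteDimensional ℝ E] (h : Metric E M) {q b : M}
    (hq : b ∈ (extChartAt 𝓘(ℝ, E) q).source) (u v w : TangentSpace 𝓘(ℝ, E) b) :
    vecCoord q (h.curvature b u v w) =
      curvatureMap (h.christoffelAt q) (extChartAt 𝓘(ℝ, E) q b)
        (vecCoord q u) (vecCoord q v) (vecCoord q w) :=
  h.tangentCoordChange_curvature hq u v w

variable (E) in
/-- The chart of the tangent bundle `TM` that belongs to the preferred chart of `M` at `q`. -/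
noncomputable abbrev tangentChart (q : M) : PartialEquiv (TangentBundle 𝓘(ℝ, E) M) (E × E) :=
  extChartAt 𝓘(ℝ, E).tangent (⟨q, (0 : E)⟩ : TangentBundle 𝓘(ℝ, E) M)

lemma tangentChart_apply (q : M) (w : TangentBundle 𝓘(ℝ, E) M) : tangentChart E q w =
    (extChartAt 𝓘(ℝ, E) q w.1, vecCoord q w.2) :=
  rfl

lemma mem_tangentChart_source {q : M} {w : TangentBundle 𝓘(ℝ, E) M} :
    w ∈ (tangentChart E q).source ↔ w.1 ∈ (extChartAt 𝓘(ℝ, E) q).source := by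
  rw [extChartAt_source, extChartAt_source, TangentBundle.mem_chart_source_iff]

lemma tangentChart_target (q : M) :
    (tangentChart E q).target = (extChartAt 𝓘(ℝ, E) q).target ×ˢ univ := by
  ext z
  constructor
  · intro hz
    have h1 := (tangentChart E q).map_target hz
    rw [mem_tangentChart_source] at h1
    have h2 := (extChartAt 𝓘(ℝ, E) q).map_source h1
    rw [← (tangentChart E q).right_inv hz, tangentChart_apply]
    exact ⟨h2, mem_univ _⟩
  · intro hz
    have h1 := (extChartAt 𝓘(ℝ, E) q).map_target hz.1
    let w : TangentBundle 𝓘(ℝ, E) M := ⟨(extChartAt 𝓘(ℝ, E) q).symm z.1,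
      tangentCoordChange 𝓘(ℝ, E) q ((extChartAt 𝓘(ℝ, E) q).symm z.1)
        ((extChartAt 𝓘(ℝ, E) q).symm z.1) z.2⟩
    have hw : tangentChart E q w = z := by
      rw [tangentChart_apply]
      exact Prod.ext ((extChartAt 𝓘(ℝ, E) q).right_inv hz.1)
        (tangentCoordChange_inverse h1 (mem_extChartAt_source _) z.2)
    rw [← hw]
    exact (tangentChart E q).map_source (mem_tangentChart_source.2 h1)

lemma tangentChart_injOn {q : M} {w₁ w₂ : TangentBundle 𝓘(ℝ, E) M}
    (h₁ : w₁.1 ∈ (extChartAt 𝓘(ℝ, E) q).source) (h₂ : w₂.1 ∈ (extChartAt 𝓘(ℝ, E) q).source)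
    (h : tangentChart E q w₁ = tangentChart E q w₂) : w₁ = w₂ :=
  (tangentChart E q).injOn (mem_tangentChart_source.2 h₁) (mem_tangentChart_source.2 h₂) h

lemma eventually_mem_source {X : Type*} [TopologicalSpace X] {c : X → TangentBundle 𝓘(ℝ, E) M}
    {S : Set X} {s : X} (hc : ContinuousWithinAt c S s) {q : M}
    (hq : (c s).1 ∈ (extChartAt 𝓘(ℝ, E) q).source) :
    ∀ᶠ t in 𝓝[S] s, (c t).1 ∈ (extChartAt 𝓘(ℝ, E) q).source :=
  ((FiberBundle.continuous_proj E (TangentSpace 𝓘(ℝ, E))).continuousAt.comp_continuousWithinAt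
    hc).eventually (extChartAt_source_mem_nhds' hq)

lemma hasDerivWithinAt_of_mfderivWithin {γ : ℝ → M} {S : Set ℝ} {s : ℝ} {q : M}
    (hγ : MDifferentiableWithinAt 𝓘(ℝ, ℝ) 𝓘(ℝ, E) γ S s)
    (hq : γ s ∈ (extChartAt 𝓘(ℝ, E) q).source) :
    HasDerivWithinAt (fun t ↦ extChartAt 𝓘(ℝ, E) q (γ t))
      (vecCoord q (velocity γ S s)) S s := by
  have hs := mem_extChartAt_source (I := 𝓘(ℝ, E)) (γ s)
  have h1 := hγ.hasMFDerivWithinAt.2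
  simp only [writtenInExtChartAt, extChartAt_self_eq, modelWithCornersSelf_coe, range_id,
    inter_univ, id_eq] at h1
  have h2 : HasFDerivAt (transition E (γ s) q) (tangentCoordChange 𝓘(ℝ, E) (γ s) q (γ s))
      (extChartAt 𝓘(ℝ, E) (γ s) (γ s)) := by
    rw [tangentCoordChange_eq_fderiv]
    exact ((contDiffAt_transition hs hq).differentiableAt (by simp)).hasFDerivAt
  have h3 := (h2.comp_hasFDerivWithinAt s h1).hasDerivWithinAt
  refine (h3.congr_of_eventuallyEq ?_ ?_).congr_deriv ?_
  · filter_upwards [hγ.continuousWithinAt.eventually (extChartAt_source_mem_nhds' hs)] with t ht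
    exact (transition_apply ht).symm
  · exact (transition_apply hs).symm
  · rfl

/-- A curve is differentiable if its coordinates are, and then its velocity is given by theirs. -/
lemma velocity_coord {γ : ℝ → M} {S : Set ℝ} {s : ℝ} {q : M} (hS : UniqueDiffWithinAt ℝ S s)
    (hc : ContinuousWithinAt γ S s) (hq : γ s ∈ (extChartAt 𝓘(ℝ, E) q).source) {a : E}
    (ha : HasDerivWithinAt (fun t ↦ extChartAt 𝓘(ℝ, E) q (γ t)) a S s) :
    MDifferentiableWithinAt 𝓘(ℝ, ℝ) 𝓘(ℝ, E) γ S s ∧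
      vecCoord q (velocity γ S s) = a := by
  have h1 : MDifferentiableWithinAt 𝓘(ℝ, ℝ) 𝓘(ℝ, E) γ S s := by
    rw [mdifferentiableWithinAt_iff_target_of_mem_source (y := q) (by rwa [extChartAt_source] at hq)]
    exact ⟨hc, ha.differentiableWithinAt.mdifferentiableWithinAt⟩
  exact ⟨h1, hS.eq_deriv _ (hasDerivWithinAt_of_mfderivWithin h1 hq) ha⟩

/-- The covariant derivative along a curve, computed in the preferred chart at any point `q`. -/
theorem Metric.covDerivCurve_coord [FiniteDimensional ℝ E] (h : Metric E M) {γ : ℝ → M} {S : Set ℝ}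
    {s : ℝ} {V : ∀ s, TangentSpace 𝓘(ℝ, E) (γ s)} {q : M} (hS : UniqueDiffWithinAt ℝ S s)
    (hc : ContinuousWithinAt γ S s) (hq : γ s ∈ (extChartAt 𝓘(ℝ, E) q).source) {a b : E}
    (ha : HasDerivWithinAt (fun t ↦ extChartAt 𝓘(ℝ, E) q (γ t)) a S s)
    (hb : HasDerivWithinAt (fun t ↦ vecCoord q (V t)) b S s) :
    vecCoord q (h.covDerivCurve γ S V s) =
      b + h.christoffelAt q (extChartAt 𝓘(ℝ, E) q (γ s)) a
        (vecCoord q (V s)) := by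
  have hps := mem_extChartAt_source (I := 𝓘(ℝ, E)) (γ s)
  let x : ℝ → E := fun t ↦ extChartAt 𝓘(ℝ, E) q (γ t)
  let u : ℝ → E := fun t ↦ vecCoord q (V t)
  let D : E → E →L[ℝ] E := fderiv ℝ (transition E q (γ s))
  -- The components with respect to the chart at `γ s` are obtained by the change of coordinates.
  have hcomp : HasDerivWithinAt
      (fun t ↦ vecCoord (γ s) (V t))
      (fderiv ℝ D (x s) a (u s) + D (x s) b) S s := by
    have key : ∀ t, γ t ∈ (extChartAt 𝓘(ℝ, E) q).source →
        γ t ∈ (extChartAt 𝓘(ℝ, E) (γ s)).source →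
        vecCoord (γ s) (V t) = D (x t) (u t) := by
      intro t ht1 ht2
      simp only [D, x, u]
      rw [← tangentCoordChange_eq_fderiv, tangentCoordChange_vecCoord ht1 ht2]
    refine (hasDerivWithinAt_fderiv_apply ((contDiffAt_transition hq hps).of_le (by norm_cast))
      ha hb).congr_of_eventuallyEq ?_ (key s hq hps)
    filter_upwards [hc.eventually (extChartAt_source_mem_nhds' hq),
      hc.eventually (extChartAt_source_mem_nhds' hps)] with t ht1 ht2 using key t ht1 ht2
  have hDT : D (x s) = tangentCoordChange 𝓘(ℝ, E) q (γ s) (γ s) :=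
    (tangentCoordChange_eq_fderiv _ _ _).symm
  have hvel : vecCoord (γ s) (velocity γ S s) = D (x s) a := by
    rw [hDT, ← (velocity_coord hS hc hq ha).2, tangentCoordChange_vecCoord hq hps]
  have hV : vecCoord (γ s) (V s) = D (x s) (u s) := by
    rw [hDT, tangentCoordChange_vecCoord hq hps]
  have hval : vecCoord (γ s) (h.covDerivCurve γ S V s) =
      D (x s) (b + h.christoffelAt q (x s) a (u s)) := by
    have h1 : vecCoord (γ s) (h.covDerivCurve γ S V s) =
        derivWithin (fun t ↦ vecCoord (γ s) (V t)) S s +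
        h.christoffel (γ s) (extChartAt 𝓘(ℝ, E) (γ s) (γ s)) (vecCoord (γ s) (velocity γ S s))
          (vecCoord (γ s) (V s)) := by
      rw [← fderivWithin_derivWithin, ← mfderivWithin_eq_fderivWithin, vecCoord_self,
        vecCoord_self, vecCoord_self]
      rfl
    rw [h1, hcomp.derivWithin hS, h.christoffel_eq, hvel, hV, hDT,
      h.christoffelAt_transition hq hps a (u s), map_add]
    simp only [D, x]
    abel
  rw [← tangentCoordChange_vecCoord hps hq, hval, hDT]
  exact tangentCoordChange_inverse hq hps _

end TangentChart

/-! ### Geodesics as integral curves of the spray -/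

section SprayCurves

variable {E : Type*} [NormedAddCommGroup E] [NormedSpace ℝ E] [FiniteDimensional ℝ E]
  {M : Type*} [TopologicalSpace M] [ChartedSpace E M] [IsManifold 𝓘(ℝ, E) ∞ M]
  (h : Metric E M)

/-- The curve `c` in the tangent bundle has at time `s` the derivative prescribed by the geodesic
spray, in every preferred chart around its base point. Derivatives are taken within `S`. -/
def Metric.IsSprayCurveAt (c : ℝ → TangentBundle 𝓘(ℝ, E) M) (S : Set ℝ) (s : ℝ) : Prop :=
  ContinuousWithinAt c S s ∧ ∀ q, (c s).1 ∈ (extChartAt 𝓘(ℝ, E) q).source →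
    HasDerivWithinAt (fun t ↦ tangentChart E q (c t))
      (spray (h.christoffelAt q) (tangentChart E q (c s))) S s

variable {h} {c c₁ c₂ : ℝ → TangentBundle 𝓘(ℝ, E) M} {S T : Set ℝ} {s : ℝ}

set_option linter.unusedSectionVars false

lemma Metric.IsSprayCurveAt.mono (hc : h.IsSprayCurveAt c S s) (hT : T ⊆ S) :
    h.IsSprayCurveAt c T s :=
  ⟨hc.1.mono hT, fun q hq ↦ (hc.2 q hq).mono hT⟩

lemma Metric.IsSprayCurveAt.continuousWithinAt_base (hc : h.IsSprayCurveAt c S s) :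
    ContinuousWithinAt (fun t ↦ (c t).1) S s :=
  (FiberBundle.continuous_proj E (TangentSpace 𝓘(ℝ, E))).continuousAt.comp_continuousWithinAt hc.1

lemma Metric.IsSprayCurveAt.hasDerivWithinAt_base (hc : h.IsSprayCurveAt c S s) {q : M}
    (hq : (c s).1 ∈ (extChartAt 𝓘(ℝ, E) q).source) :
    HasDerivWithinAt (fun t ↦ extChartAt 𝓘(ℝ, E) q (c t).1) (vecCoord q (c s).2) S s :=
  (hc.2 q hq).fst

lemma Metric.IsSprayCurveAt.hasDerivWithinAt_vecCoord (hc : h.IsSprayCurveAt c S s) {q : M}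
    (hq : (c s).1 ∈ (extChartAt 𝓘(ℝ, E) q).source) :
    HasDerivWithinAt (fun t ↦ vecCoord q (c t).2)
      (-h.christoffelAt q (extChartAt 𝓘(ℝ, E) q (c s).1) (vecCoord q (c s).2)
        (vecCoord q (c s).2)) S s :=
  (hc.2 q hq).snd

/-- The geodesic spray does not depend on the chart, by the transformation law of the Christoffel
symbols: it suffices to look at one chart. -/
lemma Metric.isSprayCurveAt_of_chart (hbase : ContinuousWithinAt (fun t ↦ (c t).1) S s) {q : M}
    (hq : (c s).1 ∈ (extChartAt 𝓘(ℝ, E) q).source)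
    (hd : HasDerivWithinAt (fun t ↦ tangentChart E q (c t))
      (spray (h.christoffelAt q) (tangentChart E q (c s))) S s) : h.IsSprayCurveAt c S s := by
  have hsrc := hbase.eventually (extChartAt_source_mem_nhds' (I := 𝓘(ℝ, E)) hq)
  refine ⟨?_, fun r hr ↦ ?_⟩
  · have h1 : ContinuousAt (tangentChart E q).symm (tangentChart E q (c s)) :=
      continuousAt_extChartAt_symm' (mem_tangentChart_source.2 hq)
    refine (h1.comp_continuousWithinAt (f := fun t ↦ tangentChart E q (c t))
      hd.continuousWithinAt).congr_of_eventuallyEq ?_ ?_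
    · filter_upwards [hsrc] with t ht
      exact ((tangentChart E q).left_inv (mem_tangentChart_source.2 ht)).symm
    · exact ((tangentChart E q).left_inv (mem_tangentChart_source.2 hq)).symm
  · have hsrc' := hbase.eventually (extChartAt_source_mem_nhds' (I := 𝓘(ℝ, E)) hr)
    have hx : HasDerivWithinAt (fun t ↦ extChartAt 𝓘(ℝ, E) q (c t).1) (vecCoord q (c s).2) S s :=
      hd.fst
    have hu : HasDerivWithinAt (fun t ↦ vecCoord q (c t).2)
        (-h.christoffelAt q (extChartAt 𝓘(ℝ, E) q (c s).1) (vecCoord q (c s).2)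
          (vecCoord q (c s).2)) S s := hd.snd
    have hφ := contDiffAt_transition hq hr
    have h1 := (hφ.differentiableAt (by simp)).hasFDerivAt.comp_hasDerivWithinAt s hx
    have h2 := hasDerivWithinAt_fderiv_apply (hφ.of_le (by norm_cast)) hx hu
    have key : ∀ t, (c t).1 ∈ (extChartAt 𝓘(ℝ, E) q).source →
        (c t).1 ∈ (extChartAt 𝓘(ℝ, E) r).source → tangentChart E r (c t) =
        (transition E q r (extChartAt 𝓘(ℝ, E) q (c t).1),
          fderiv ℝ (transition E q r) (extChartAt 𝓘(ℝ, E) q (c t).1) (vecCoord q (c t).2)) := by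
      intro t ht ht'
      rw [tangentChart_apply, transition_apply ht, ← tangentCoordChange_eq_fderiv,
        tangentCoordChange_vecCoord ht ht']
    refine ((h1.prodMk h2).congr_of_eventuallyEq ?_ (key s hq hr)).congr_deriv ?_
    · filter_upwards [hsrc, hsrc'] with t ht ht' using key t ht ht'
    · rw [tangentChart_apply, spray]
      refine Prod.ext ?_ ?_
      · rw [← tangentCoordChange_eq_fderiv, tangentCoordChange_vecCoord hq hr]
      · rw [← tangentCoordChange_vecCoord hq hr, h.christoffelAt_transition hq hr,
          ← tangentCoordChange_eq_fderiv, map_neg, neg_sub, sub_eq_add_neg]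

/-- An integral curve of the spray in coordinates defines one in the tangent bundle. -/
lemma Metric.isSprayCurveAt_symm {q : M} {z : ℝ → E × E}
    (hz : ∀ᶠ t in 𝓝[S] s, z t ∈ (extChartAt 𝓘(ℝ, E) q).target ×ˢ univ)
    (hs : z s ∈ (extChartAt 𝓘(ℝ, E) q).target ×ˢ univ)
    (hd : HasDerivWithinAt z (spray (h.christoffelAt q) (z s)) S s) :
    h.IsSprayCurveAt (fun t ↦ (tangentChart E q).symm (z t)) S s := by
  simp only [← tangentChart_target] at hz hs
  have hr := (tangentChart E q).right_inv hs
  have hsrc := (tangentChart E q).map_target hs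
  have hcont : ContinuousWithinAt (fun t ↦ (tangentChart E q).symm (z t)) S s := by
    have h1 := continuousAt_extChartAt_symm' (I := 𝓘(ℝ, E).tangent) hsrc
    rw [hr] at h1
    exact h1.comp_continuousWithinAt hd.continuousWithinAt
  refine h.isSprayCurveAt_of_chart (q := q)
    ((FiberBundle.continuous_proj E (TangentSpace 𝓘(ℝ, E))).continuousAt.comp_continuousWithinAt
      hcont) (mem_tangentChart_source.1 hsrc) ?_
  simp only [hr]
  refine hd.congr_of_eventuallyEq ?_ hr
  filter_upwards [hz] with t ht using (tangentChart E q).right_inv ht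

/-- Two curves in the tangent bundle of a Hausdorff manifold that differ at a time differ at nearby
times. -/
lemma eventually_ne_of_ne [T2Space M] (hc₁ : ContinuousWithinAt c₁ S s)
    (hc₂ : ContinuousWithinAt c₂ S s) (hne : c₁ s ≠ c₂ s) : ∀ᶠ t in 𝓝[S] s, c₁ t ≠ c₂ t := by
  have hproj := FiberBundle.continuous_proj E (TangentSpace 𝓘(ℝ, E) (M := M))
  by_cases hb : (c₁ s).1 = (c₂ s).1
  · have hs₁ := mem_extChartAt_source (I := 𝓘(ℝ, E)) (c₁ s).1
    have hs₂ : (c₂ s).1 ∈ (extChartAt 𝓘(ℝ, E) (c₁ s).1).source := hb ▸ hs₁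
    have h1 := (continuousAt_extChartAt' (I := 𝓘(ℝ, E).tangent)
      (mem_tangentChart_source.2 hs₁)).comp_continuousWithinAt hc₁
    have h2 := (continuousAt_extChartAt' (I := 𝓘(ℝ, E).tangent)
      (mem_tangentChart_source.2 hs₂)).comp_continuousWithinAt hc₂
    have h3 := (h1.prodMk h2).eventually (isClosed_diagonal.isOpen_compl.mem_nhds
      fun heq ↦ hne (tangentChart_injOn hs₁ hs₂ heq))
    filter_upwards [h3] with t ht heq
    exact ht (congrArg (tangentChart E (c₁ s).1) heq)
  · have h3 := ((hproj.continuousAt.comp_continuousWithinAt hc₁).prodMk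
      (hproj.continuousAt.comp_continuousWithinAt hc₂)).eventually
      (isClosed_diagonal.isOpen_compl.mem_nhds hb)
    filter_upwards [h3] with t ht heq
    exact ht (congrArg TotalSpace.proj heq)

/-- A smooth vector field is Lipschitz near each point of its domain. -/
lemma exists_lipschitzOnWith {W : Type*} [NormedAddCommGroup W] [NormedSpace ℝ W] {F : W → W}
    {U : Set W} (hU : IsOpen U) (hF : ContDiffOn ℝ ∞ F U) {w : W} (hw : w ∈ U) :
    ∃ K : NNReal, ∃ D ∈ 𝓝 w, LipschitzOnWith K F D :=
  ((hF.contDiffAt (hU.mem_nhds hw)).of_le (by norm_cast)).exists_lipschitzOnWith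

/-- Uniqueness of geodesics, near a time. -/
lemma Metric.IsSprayCurveAt.eventually_eq [S.OrdConnected]
    (hc₁ : ∀ t ∈ S, h.IsSprayCurveAt c₁ S t) (hc₂ : ∀ t ∈ S, h.IsSprayCurveAt c₂ S t) (hs : s ∈ S)
    (heq : c₁ s = c₂ s) : ∀ᶠ t in 𝓝[S] s, c₁ t = c₂ t := by
  let q := (c₁ s).1
  have hq₁ : (c₁ s).1 ∈ (extChartAt 𝓘(ℝ, E) q).source := mem_extChartAt_source _
  have hq₂ : (c₂ s).1 ∈ (extChartAt 𝓘(ℝ, E) q).source := heq ▸ hq₁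
  obtain ⟨K, D, hD, hLip⟩ := exists_lipschitzOnWith
    ((isOpen_extChartAt_target q).prod isOpen_univ)
    (contDiffOn_spray (h.contDiffOn_christoffelAt q))
    (w := tangentChart E q (c₁ s)) ⟨(extChartAt 𝓘(ℝ, E) q).map_source hq₁, mem_univ _⟩
  have hall : ∀ᶠ t in 𝓝[S] s, ((c₁ t).1 ∈ (extChartAt 𝓘(ℝ, E) q).source ∧
      (c₂ t).1 ∈ (extChartAt 𝓘(ℝ, E) q).source) ∧
      tangentChart E q (c₁ t) ∈ D ∧ tangentChart E q (c₂ t) ∈ D := by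
    refine ((eventually_mem_source (hc₁ s hs).1 hq₁).and
      (eventually_mem_source (hc₂ s hs).1 hq₂)).and
      (((hc₁ s hs).2 q hq₁).continuousWithinAt.eventually hD |>.and
      (((hc₂ s hs).2 q hq₂).continuousWithinAt.eventually (by simp only [← heq]; exact hD)))
  obtain ⟨ε, hε, hball⟩ := Metric.mem_nhdsWithin_iff.1 hall
  have hord : (Metric.ball s ε ∩ S).OrdConnected := by
    rw [Real.ball_eq_Ioo]
    exact ordConnected_Ioo.inter ‹_›
  have h1 := eqOn_of_hasDerivWithinAt (S := Metric.ball s ε ∩ S) (t₀ := s)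
    (v := fun _ ↦ spray (h.christoffelAt q)) (K := K) (D := D) (fun _ _ ↦ hLip)
    (f := fun t ↦ tangentChart E q (c₁ t)) (g := fun t ↦ tangentChart E q (c₂ t))
    (fun t ht ↦ ((hc₁ t ht.2).2 q (hball ht).1.1).mono inter_subset_right)
    (fun t ht ↦ (hball ht).2.1)
    (fun t ht ↦ ((hc₂ t ht.2).2 q (hball ht).1.2).mono inter_subset_right)
    (fun t ht ↦ (hball ht).2.2) ⟨Metric.mem_ball_self hε, hs⟩ (congrArg _ heq)
  filter_upwards [inter_mem_nhdsWithin S (Metric.ball_mem_nhds s hε)] with t ht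
  have ht' : t ∈ Metric.ball s ε ∩ S := ⟨ht.2, ht.1⟩
  exact tangentChart_injOn (hball ht').1.1 (hball ht').1.2 (h1 ht')

/-- Uniqueness of geodesics. -/
theorem Metric.IsSprayCurveAt.eqOn [T2Space M] [S.OrdConnected]
    (hc₁ : ∀ t ∈ S, h.IsSprayCurveAt c₁ S t) (hc₂ : ∀ t ∈ S, h.IsSprayCurveAt c₂ S t) (hs : s ∈ S)
    (heq : c₁ s = c₂ s) : EqOn c₁ c₂ S := by
  intro t ht
  refine (IsPreconnected.induction₂ (s := S) (Set.OrdConnected.isPreconnected ‹_›)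
    (fun a b ↦ c₁ a = c₂ a ↔ c₁ b = c₂ b) (fun a ha ↦ ?_) (fun _ _ _ _ _ _ ↦ Iff.trans)
    (fun _ _ _ _ ↦ Iff.symm) hs ht).1 heq
  by_cases hne : c₁ a = c₂ a
  · filter_upwards [Metric.IsSprayCurveAt.eventually_eq hc₁ hc₂ ha hne] with b hb
    exact iff_of_true hne hb
  · filter_upwards [eventually_ne_of_ne (hc₁ a ha).1 (hc₂ a ha).1 hne] with b hb
    exact iff_of_false hne hb

lemma Metric.IsSprayCurveAt.velocity_eq (hc : h.IsSprayCurveAt c S s)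
    (hS : UniqueDiffWithinAt ℝ S s) : velocity (fun t ↦ (c t).1) S s = (c s).2 := by
  have hq := mem_extChartAt_source (I := 𝓘(ℝ, E)) (c s).1
  exact vecCoord_injective hq (velocity_coord hS hc.continuousWithinAt_base hq
    (hc.hasDerivWithinAt_base hq)).2

/-- The base curve of a smooth integral curve of the spray is a geodesic. -/
lemma Metric.isGeodesicOn_of_isSprayCurveAt (hS : UniqueDiffOn ℝ S)
    (hsm : ContMDiffOn 𝓘(ℝ, ℝ) 𝓘(ℝ, E) ∞ (fun t ↦ (c t).1) S)
    (hc : ∀ t ∈ S, h.IsSprayCurveAt c S t) : h.IsGeodesicOn (fun t ↦ (c t).1) S := by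
  refine ⟨hsm, fun s hs ↦ ?_⟩
  have hq := mem_extChartAt_source (I := 𝓘(ℝ, E)) (c s).1
  have hcov := h.covDerivCurve_coord (V := velocity (fun t ↦ (c t).1) S) (hS s hs)
    (hsm s hs).continuousWithinAt hq ((hc s hs).hasDerivWithinAt_base hq)
    (((hc s hs).hasDerivWithinAt_vecCoord hq).congr
      (fun t ht ↦ by rw [(hc t ht).velocity_eq (hS t ht)])
      (by rw [(hc s hs).velocity_eq (hS s hs)]))
  rw [(hc s hs).velocity_eq (hS s hs), neg_add_cancel] at hcov
  refine vecCoord_injective hq (hcov.trans ?_)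
  exact (map_zero (tangentCoordChange 𝓘(ℝ, E) (c s).1 (c s).1 (c s).1)).symm

/-- A geodesic together with its velocity is an integral curve of the spray. -/
lemma Metric.IsGeodesicOn.isSprayCurveAt {γ : ℝ → M} (hγ : h.IsGeodesicOn γ S)
    (hS : UniqueDiffOn ℝ S) (hs : s ∈ S) :
    h.IsSprayCurveAt (fun t ↦ ⟨γ t, velocity γ S t⟩) S s := by
  have hq := mem_extChartAt_source (I := 𝓘(ℝ, E)) (γ s)
  have hmd : ∀ t ∈ S, MDifferentiableWithinAt 𝓘(ℝ, ℝ) 𝓘(ℝ, E) γ S t := fun t ht ↦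
    (hγ.contMDiffOn t ht).mdifferentiableWithinAt (by simp)
  have hx : ContDiffWithinAt ℝ ∞ (fun t ↦ extChartAt 𝓘(ℝ, E) (γ s) (γ t)) S s := by
    rw [← contMDiffWithinAt_iff_contDiffWithinAt]
    exact (contMDiffAt_extChartAt' (by rwa [extChartAt_source] at hq)).comp_contMDiffWithinAt s
      (hγ.contMDiffOn s hs)
  have hv : DifferentiableWithinAt ℝ
      (derivWithin (fun t ↦ extChartAt 𝓘(ℝ, E) (γ s) (γ t)) S) S s := by
    have h1 := (hx.fderivWithin_right (m := 1) hS (by norm_cast) hs).differentiableWithinAt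
      (by norm_num)
    exact h1.clm_apply (differentiableWithinAt_const 1)
  have heq : ∀ t ∈ S, γ t ∈ (extChartAt 𝓘(ℝ, E) (γ s)).source →
      vecCoord (γ s) (velocity γ S t) =
        derivWithin (fun t ↦ extChartAt 𝓘(ℝ, E) (γ s) (γ t)) S t := fun t ht htq ↦
    ((hasDerivWithinAt_of_mfderivWithin (hmd t ht) htq).derivWithin (hS t ht)).symm
  have hb : HasDerivWithinAt (fun t ↦ vecCoord (γ s) (velocity γ S t)) _ S s :=
    hv.hasDerivWithinAt.congr_of_eventuallyEq (by
      filter_upwards [self_mem_nhdsWithin, (hmd s hs).continuousWithinAt.eventually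
        (extChartAt_source_mem_nhds' (I := 𝓘(ℝ, E)) hq)] with t ht htq using heq t ht htq)
      (heq s hs hq)
  have ha := hasDerivWithinAt_of_mfderivWithin (hmd s hs) hq
  have hcov := h.covDerivCurve_coord (hS s hs) (hmd s hs).continuousWithinAt hq ha hb
  have h0 : vecCoord (γ s) (h.covDerivCurve γ S (velocity γ S) s) = 0 := by
    rw [hγ.eq_zero s hs]
    exact map_zero (tangentCoordChange 𝓘(ℝ, E) (γ s) (γ s) (γ s))
  refine h.isSprayCurveAt_of_chart (hmd s hs).continuousWithinAt hq ((ha.prodMk hb).congr_deriv ?_)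
  exact Prod.ext rfl (eq_neg_of_add_eq_zero_left (hcov.symm.trans h0))

/-- Multiplying the parameter of a geodesic by a constant. -/
lemma Metric.IsSprayCurveAt.rescale {a : ℝ} (hc : h.IsSprayCurveAt c univ (a * s)) :
    h.IsSprayCurveAt (fun t ↦ ⟨(c (a * t)).1, a • (c (a * t)).2⟩) S s := by
  have hq := mem_extChartAt_source (I := 𝓘(ℝ, E)) (c (a * s)).1
  have hm : HasDerivWithinAt (fun t ↦ a * t) a S s := by
    simpa using (hasDerivWithinAt_id s S).const_mul a
  have hx := (hc.hasDerivWithinAt_base hq).scomp s hm (mapsTo_univ _ _)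
  have hu := ((hc.hasDerivWithinAt_vecCoord hq).scomp s hm (mapsTo_univ _ _)).const_smul a
  have hsmul : ∀ t, vecCoord (c (a * s)).1 (a • (c (a * t)).2) =
      a • vecCoord (c (a * s)).1 (c (a * t)).2 := fun t ↦
    map_smul (tangentCoordChange 𝓘(ℝ, E) (c (a * t)).1 (c (a * s)).1 (c (a * t)).1) a _
  refine h.isSprayCurveAt_of_chart (q := (c (a * s)).1) ?_ hq ?_
  · exact hc.continuousWithinAt_base.comp hm.continuousWithinAt (mapsTo_univ _ _)
  · have key : ∀ t, tangentChart E (c (a * s)).1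
        (⟨(c (a * t)).1, a • (c (a * t)).2⟩ : TangentBundle 𝓘(ℝ, E) M) =
        (extChartAt 𝓘(ℝ, E) (c (a * s)).1 (c (a * t)).1,
          a • vecCoord (c (a * s)).1 (c (a * t)).2) := fun t ↦ by
      rw [tangentChart_apply, hsmul]
    refine ((hx.prodMk hu).congr (fun t _ ↦ key t) (key s)).congr_deriv ?_
    rw [key, spray]
    simp

/-- The exponential map in terms of integral curves of the spray. -/
lemma Metric.exp_eq [T2Space M] (hsm : ContMDiffOn 𝓘(ℝ, ℝ) 𝓘(ℝ, E) ∞ (fun t ↦ (c t).1) (Icc 0 1))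
    (hc : ∀ t ∈ Icc (0 : ℝ) 1, h.IsSprayCurveAt c (Icc 0 1) t) :
    h.exp (c 0).1 (c 0).2 = (c 1).1 := by
  have hS : UniqueDiffOn ℝ (Icc (0 : ℝ) 1) := uniqueDiffOn_Icc zero_lt_one
  have hex : ∃ γ : ℝ → M, h.IsGeodesicOn γ (Icc 0 1) ∧
      (⟨γ 0, velocity γ (Icc 0 1) 0⟩ : TangentBundle 𝓘(ℝ, E) M) = ⟨(c 0).1, (c 0).2⟩ := by
    refine ⟨fun t ↦ (c t).1, h.isGeodesicOn_of_isSprayCurveAt hS hsm hc, ?_⟩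
    rw [(hc 0 (by simp)).velocity_eq (hS 0 (by simp))]
  rw [Metric.exp, dif_pos hex]
  obtain ⟨h1, h2⟩ := hex.choose_spec
  exact congrArg TotalSpace.proj (Metric.IsSprayCurveAt.eqOn (fun t ht ↦ h1.isSprayCurveAt hS ht) hc
    (s := 0) (by simp) h2 (right_mem_Icc.2 zero_le_one))

/-- The exponential map along a ray. -/
lemma Metric.exp_smul_eq [T2Space M] (hsm : ContMDiff 𝓘(ℝ, ℝ) 𝓘(ℝ, E) ∞ (fun t ↦ (c t).1))
    (hc : ∀ t, h.IsSprayCurveAt c univ t) (a : ℝ) : h.exp (c 0).1 (a • (c 0).2) = (c a).1 := by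
  have h1 := h.exp_eq (c := fun t ↦ ⟨(c (a * t)).1, a • (c (a * t)).2⟩)
    (hsm.comp (contMDiff_iff_contDiff.2 (contDiff_const.mul contDiff_id))).contMDiffOn
    fun t _ ↦ (hc (a * t)).rescale
  have h0 : c (a * 0) = c 0 := by rw [mul_zero]
  simp only [mul_one] at h1
  rwa [h0] at h1

end SprayCurves

/-! ### Variations through geodesics -/

section DirDeriv

variable {E' : Type*} [NormedAddCommGroup E'] [NormedSpace ℝ E']
  {H' : Type*} [TopologicalSpace H'] (I' : ModelWithCorners ℝ E' H')
  {N : Type*} [TopologicalSpace N] [ChartedSpace H' N]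
  {W W' : Type*} [NormedAddCommGroup W] [NormedSpace ℝ W] [NormedAddCommGroup W'] [NormedSpace ℝ W']

/-- The derivative at `x` of a function with values in a vector space in the direction `ξ`. -/
noncomputable def dirDeriv (f : N → W) (x : N) (ξ : TangentSpace I' x) : W :=
  mfderiv I' 𝓘(ℝ, W) f x ξ

variable {I'} {f g : N → W} {x : N} {ξ : TangentSpace I' x}

lemma dirDeriv_congr (hfg : f =ᶠ[𝓝 x] g) : dirDeriv I' f x ξ = dirDeriv I' g x ξ := by
  unfold dirDeriv
  rw [hfg.mfderiv_eq]
  rfl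

lemma dirDeriv_comp {F : W → W'} {F' : W →L[ℝ] W'} (hF : HasFDerivAt F F' (f x))
    (hf : MDifferentiableAt I' 𝓘(ℝ, W) f x) :
    dirDeriv I' (fun y ↦ F (f y)) x ξ = F' (dirDeriv I' f x ξ) := by
  have h1 := (hF.hasMFDerivAt.comp x hf.hasMFDerivAt).mfderiv
  exact DFunLike.congr_fun h1 ξ

end DirDeriv

section Variation

set_option linter.unusedSectionVars false

variable {E : Type*} [NormedAddCommGroup E] [NormedSpace ℝ E]
  {M : Type*} [TopologicalSpace M] [ChartedSpace E M] [IsManifold 𝓘(ℝ, E) ∞ M]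
  {E' : Type*} [NormedAddCommGroup E'] [NormedSpace ℝ E']
  {H' : Type*} [TopologicalSpace H'] {I' : ModelWithCorners ℝ E' H'}
  {N : Type*} [TopologicalSpace N] [ChartedSpace H' N]
  {x : N} {ξ : TangentSpace I' x}

lemma vecCoord_mfderiv {f : N → M} (hf : MDifferentiableAt I' 𝓘(ℝ, E) f x) {q : M}
    (hq : f x ∈ (extChartAt 𝓘(ℝ, E) q).source) :
    vecCoord q (mfderiv I' 𝓘(ℝ, E) f x ξ) =
      dirDeriv I' (fun y ↦ extChartAt 𝓘(ℝ, E) q (f y)) x ξ := by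
  have hq' : f x ∈ (chartAt E q).source := by rwa [extChartAt_source] at hq
  have h1 := mfderiv_comp x (mdifferentiableAt_extChartAt (I := 𝓘(ℝ, E)) hq') hf
  have h2 := mfderiv_chartAt_eq_tangentCoordChange (I := 𝓘(ℝ, E)) hq'
  have h3 : mfderiv 𝓘(ℝ, E) 𝓘(ℝ, E) (extChartAt 𝓘(ℝ, E) q) (f x) =
    tangentCoordChange 𝓘(ℝ, E) (f x) q (f x) := h2
  rw [h3] at h1
  exact (DFunLike.congr_fun h1 ξ).symm

lemma mdifferentiableAt_tangentChart {f : N → TangentBundle 𝓘(ℝ, E) M} {q : M}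
    (hf : MDifferentiableAt I' 𝓘(ℝ, E).tangent f x)
    (hq : (f x).1 ∈ (extChartAt 𝓘(ℝ, E) q).source) :
    MDifferentiableAt I' 𝓘(ℝ, E × E) (fun y ↦ tangentChart E q (f y)) x := by
  have h1 := mem_tangentChart_source.2 hq
  rw [extChartAt_source] at h1
  exact ((mdifferentiableAt_iff_target_of_mem_source h1).1 hf).2

lemma mdifferentiableAt_of_tangentChart {f : N → TangentBundle 𝓘(ℝ, E) M} {q : M}
    (hsrc : ∀ᶠ y in 𝓝 x, (f y).1 ∈ (extChartAt 𝓘(ℝ, E) q).source)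
    (hf : MDifferentiableAt I' 𝓘(ℝ, E × E) (fun y ↦ tangentChart E q (f y)) x) :
    MDifferentiableAt I' 𝓘(ℝ, E).tangent f x := by
  have h1 := mem_tangentChart_source.2 hsrc.self_of_nhds
  have h2 := h1
  rw [extChartAt_source] at h2
  refine (mdifferentiableAt_iff_target_of_mem_source h2).2 ⟨?_, hf⟩
  have h3 : ContinuousAt (tangentChart E q).symm (tangentChart E q (f x)) :=
    continuousAt_extChartAt_symm' h1
  refine (h3.comp (f := fun y ↦ tangentChart E q (f y)) hf.continuousAt).congr ?_
  filter_upwards [hsrc] with y hy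
  exact (tangentChart E q).left_inv (mem_tangentChart_source.2 hy)

variable [FiniteDimensional ℝ E] [T2Space M] {h : Metric E M}
  {c : N → ℝ → TangentBundle 𝓘(ℝ, E) M}

/-- Near a time `t₀`, a family of integral curves of the spray that depends differentiably on the
parameter at one time does so at all times, and its derivative with respect to the parameter solves
the variational equation. -/
theorem Metric.exists_variational (hc : ∀ y t, h.IsSprayCurveAt (c y) univ t) {t₀ : ℝ} {q : M}
    (hq : (c x t₀).1 ∈ (extChartAt 𝓘(ℝ, E) q).source) :
    ∃ δ > 0, ∀ t₁ ∈ Metric.ball t₀ δ, MDifferentiableAt I' 𝓘(ℝ, E).tangent (fun y ↦ c y t₁) x →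
      ∀ t ∈ Metric.ball t₀ δ, MDifferentiableAt I' 𝓘(ℝ, E).tangent (fun y ↦ c y t) x ∧
        HasDerivAt (fun t ↦ dirDeriv I' (fun y ↦ tangentChart E q (c y t)) x ξ)
          (fderiv ℝ (spray (h.christoffelAt q)) (tangentChart E q (c x t))
            (dirDeriv I' (fun y ↦ tangentChart E q (c y t)) x ξ)) t := by
  have := FiniteDimensional.complete ℝ (E × E)
  obtain ⟨r, hr, ε, hε, Φ, L, hΦ⟩ := exists_differentiable_localFlow
    ((isOpen_extChartAt_target q).prod isOpen_univ)
    (contDiffOn_spray (h.contDiffOn_christoffelAt q))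
    (w₀ := tangentChart E q (c x t₀)) ⟨(extChartAt 𝓘(ℝ, E) q).map_source hq, mem_univ _⟩
  have hnear : ∀ᶠ t in 𝓝 t₀, (c x t).1 ∈ (extChartAt 𝓘(ℝ, E) q).source ∧
      tangentChart E q (c x t) ∈ Metric.ball (tangentChart E q (c x t₀)) r := by
    have h1 := eventually_mem_source (hc x t₀).1 hq
    have h2 := ((hc x t₀).2 q hq).continuousWithinAt
    rw [continuousWithinAt_univ] at h2
    rw [nhdsWithin_univ] at h1
    exact h1.and (h2.eventually (Metric.ball_mem_nhds _ hr))
  obtain ⟨δ', hδ', hball⟩ := Metric.eventually_nhds_iff_ball.1 hnear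
  refine ⟨min δ' (ε / 2), lt_min hδ' (half_pos hε), fun t₁ ht₁ hQ ↦ ?_⟩
  have hsmall : ∀ t ∈ Metric.ball t₀ (min δ' (ε / 2)), t - t₁ ∈ Ioo (-ε) ε := by
    intro t ht
    rw [Metric.mem_ball, Real.dist_eq, abs_lt] at ht ht₁
    have := min_le_right δ' (ε / 2)
    constructor <;> linarith [ht.1, ht.2, ht₁.1, ht₁.2]
  have hb₁ := hball t₁ (Metric.ball_subset_ball (min_le_left _ _) ht₁)
  -- By uniqueness the curves are given by the local flow.
  have hflow : ∀ y, (c y t₁).1 ∈ (extChartAt 𝓘(ℝ, E) q).source →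
      tangentChart E q (c y t₁) ∈ Metric.ball (tangentChart E q (c x t₀)) r →
      ∀ t, t - t₁ ∈ Ioo (-ε) ε → (c y t).1 ∈ (extChartAt 𝓘(ℝ, E) q).source ∧
        tangentChart E q (c y t) = Φ (tangentChart E q (c y t₁)) (t - t₁) := by
    intro y hy₁ hy₂ t ht
    obtain ⟨h0, -, hΦy⟩ := hΦ _ hy₂
    have hmem : ∀ s ∈ Ioo (t₁ - ε) (t₁ + ε), s - t₁ ∈ Ioo (-ε) ε := fun s hs ↦
      ⟨by linarith [hs.1], by linarith [hs.2]⟩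
    have hspray : ∀ s ∈ Ioo (t₁ - ε) (t₁ + ε), h.IsSprayCurveAt
        (fun t ↦ (tangentChart E q).symm (Φ (tangentChart E q (c y t₁)) (t - t₁)))
        (Ioo (t₁ - ε) (t₁ + ε)) s := by
      intro s hs
      refine h.isSprayCurveAt_symm (z := fun t ↦ Φ (tangentChart E q (c y t₁)) (t - t₁)) ?_
        (hΦy _ (hmem s hs)).1 ?_
      · filter_upwards [self_mem_nhdsWithin] with t' ht' using (hΦy _ (hmem t' ht')).1
      · exact ((hΦy _ (hmem s hs)).2.1.comp_sub_const s t₁).hasDerivWithinAt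
    have heq := Metric.IsSprayCurveAt.eqOn (fun s _ ↦ (hc y s).mono (subset_univ _)) hspray
      (s := t₁) ⟨by linarith, by linarith⟩ (by
        rw [sub_self, h0]
        exact ((tangentChart E q).left_inv (mem_tangentChart_source.2 hy₁)).symm)
    have htt := (hΦy _ ht).1
    rw [← tangentChart_target] at htt
    have hct := heq (x := t) ⟨by linarith [ht.1], by linarith [ht.2]⟩
    constructor
    · rw [hct]
      exact mem_tangentChart_source.1 ((tangentChart E q).map_target htt)
    · rw [hct]
      exact (tangentChart E q).right_inv htt
  have hdiff₁ := mdifferentiableAt_tangentChart hQ hb₁.1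
  have hev : ∀ᶠ y in 𝓝 x, (c y t₁).1 ∈ (extChartAt 𝓘(ℝ, E) q).source ∧
      tangentChart E q (c y t₁) ∈ Metric.ball (tangentChart E q (c x t₀)) r := by
    refine .and ?_ (hdiff₁.continuousAt.eventually (Metric.isOpen_ball.mem_nhds hb₁.2))
    have h1 := eventually_mem_source (c := fun y ↦ c y t₁)
      ((continuousWithinAt_univ _ _).2 hQ.continuousAt) hb₁.1
    rwa [nhdsWithin_univ] at h1
  have hcongr : ∀ t, t - t₁ ∈ Ioo (-ε) ε → (fun y ↦ tangentChart E q (c y t)) =ᶠ[𝓝 x]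
      fun y ↦ Φ (tangentChart E q (c y t₁)) (t - t₁) := fun t ht ↦ by
    filter_upwards [hev] with y hy using (hflow y hy.1 hy.2 t ht).2
  obtain ⟨-, -, hΦx⟩ := hΦ _ hb₁.2
  have hζ : ∀ t, t - t₁ ∈ Ioo (-ε) ε → dirDeriv I' (fun y ↦ tangentChart E q (c y t)) x ξ =
      L (tangentChart E q (c x t₁)) (t - t₁)
        (dirDeriv I' (fun y ↦ tangentChart E q (c y t₁)) x ξ) := fun t ht ↦ by
    rw [dirDeriv_congr (hcongr t ht)]
    exact dirDeriv_comp (F := fun w ↦ Φ w (t - t₁)) (hΦx _ ht).2.2.1 hdiff₁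
  intro t ht
  have ht' := hsmall t ht
  constructor
  · refine mdifferentiableAt_of_tangentChart (q := q) ?_ ?_
    · filter_upwards [hev] with y hy using (hflow y hy.1 hy.2 t ht').1
    · refine MDifferentiableAt.congr_of_eventuallyEq ?_ (hcongr t ht')
      exact (hΦx _ ht').2.2.1.hasMFDerivAt.mdifferentiableAt.comp x hdiff₁
  · have h1 := ((hΦx _ ht').2.2.2.comp_sub_const t t₁).clm_apply (hasDerivAt_const t
      (dirDeriv I' (fun y ↦ tangentChart E q (c y t₁)) x ξ))
    refine (h1.congr_of_eventuallyEq ?_).congr_deriv ?_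
    · filter_upwards [Metric.isOpen_ball.mem_nhds ht] with s hs using hζ s (hsmall s hs)
    · rw [hζ t ht', (hflow x hb₁.1 hb₁.2 t ht').2]
      simp

/-- A family of geodesics defined for all times depends differentiably on the initial condition. -/
theorem Metric.mdifferentiableAt_variation (hc : ∀ y t, h.IsSprayCurveAt (c y) univ t)
    (h0 : MDifferentiableAt I' 𝓘(ℝ, E).tangent (fun y ↦ c y 0) x) (t : ℝ) :
    MDifferentiableAt I' 𝓘(ℝ, E).tangent (fun y ↦ c y t) x := by
  -- By the local statement, the set of times at which differentiability holds is open and closed.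
  refine (isPreconnected_univ (α := ℝ).induction₂
    (fun a b ↦ MDifferentiableAt I' 𝓘(ℝ, E).tangent (fun y ↦ c y a) x ↔
      MDifferentiableAt I' 𝓘(ℝ, E).tangent (fun y ↦ c y b) x) (fun a _ ↦ ?_)
    (fun _ _ _ _ _ _ ↦ Iff.trans) (fun _ _ _ _ ↦ Iff.symm) (mem_univ 0) (mem_univ t)).1 h0
  obtain ⟨δ, hδ, hball⟩ := Metric.exists_variational (I' := I') (x := x) (ξ := 0) hc
    (mem_extChartAt_source (I := 𝓘(ℝ, E)) (c x a).1)
  rw [nhdsWithin_univ]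
  filter_upwards [Metric.ball_mem_nhds a hδ] with b hb
  exact ⟨fun H ↦ (hball a (Metric.mem_ball_self hδ) H b hb).1,
    fun H ↦ (hball b hb H a (Metric.mem_ball_self hδ)).1⟩

lemma Metric.hasDerivAt_variation (hc : ∀ y t, h.IsSprayCurveAt (c y) univ t)
    (h0 : MDifferentiableAt I' 𝓘(ℝ, E).tangent (fun y ↦ c y 0) x) {t : ℝ} {q : M}
    (hq : (c x t).1 ∈ (extChartAt 𝓘(ℝ, E) q).source) :
    HasDerivAt (fun t ↦ dirDeriv I' (fun y ↦ tangentChart E q (c y t)) x ξ)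
      (fderiv ℝ (spray (h.christoffelAt q)) (tangentChart E q (c x t))
        (dirDeriv I' (fun y ↦ tangentChart E q (c y t)) x ξ)) t := by
  obtain ⟨δ, hδ, hball⟩ := Metric.exists_variational (I' := I') (x := x) (ξ := ξ) hc hq
  exact (hball t (Metric.mem_ball_self hδ) (Metric.mdifferentiableAt_variation hc h0 t) t
    (Metric.mem_ball_self hδ)).2

end Variation

/-! ### The Jacobi equation as a first order system -/

section JacobiSystem

variable {E : Type*} [NormedAddCommGroup E] [NormedSpace ℝ E]

/-- The first order system for a geodesic `x` with velocity `v` and a Jacobi field `u` along it with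
covariant derivative `p`, at the point `((x, v), (u, p))`. -/
noncomputable def jacobiSystem (Γ : E → E →L[ℝ] E →L[ℝ] E) (w : (E × E) × (E × E)) :
    (E × E) × (E × E) :=
  (spray Γ w.1, (w.2.2 - Γ w.1.1 w.1.2 w.2.1,
    -curvatureMap Γ w.1.1 w.2.1 w.1.2 w.1.2 - Γ w.1.1 w.1.2 w.2.2))

lemma contDiffOn_jacobiSystem {Γ : E → E →L[ℝ] E →L[ℝ] E} {U : Set E} (hU : IsOpen U)
    (hΓ : ContDiffOn ℝ ∞ Γ U) :
    ContDiffOn ℝ ∞ (jacobiSystem Γ) ((U ×ˢ univ) ×ˢ univ) := by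
  have hmaps : MapsTo (fun w : (E × E) × (E × E) ↦ w.1.1) ((U ×ˢ univ) ×ˢ univ) U :=
    fun w hw ↦ hw.1.1
  have hx : ContDiffOn ℝ ∞ (fun w : (E × E) × (E × E) ↦ w.1.1) ((U ×ˢ univ) ×ˢ univ) :=
    contDiff_fst.fst.contDiffOn
  have hv : ContDiffOn ℝ ∞ (fun w : (E × E) × (E × E) ↦ w.1.2) ((U ×ˢ univ) ×ˢ univ) :=
    contDiff_fst.snd.contDiffOn
  have hu : ContDiffOn ℝ ∞ (fun w : (E × E) × (E × E) ↦ w.2.1) ((U ×ˢ univ) ×ˢ univ) :=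
    contDiff_snd.fst.contDiffOn
  have hp : ContDiffOn ℝ ∞ (fun w : (E × E) × (E × E) ↦ w.2.2) ((U ×ˢ univ) ×ˢ univ) :=
    contDiff_snd.snd.contDiffOn
  have hG := hΓ.comp hx hmaps
  have hDG := (hΓ.fderiv_of_isOpen (m := ∞) hU (by simp)).comp hx hmaps
  have h1 : ContDiffOn ℝ ∞ (fun w : (E × E) × (E × E) ↦ spray Γ w.1) ((U ×ˢ univ) ×ˢ univ) :=
    (contDiffOn_spray hΓ).comp contDiff_fst.contDiffOn fun w hw ↦ hw.1
  refine h1.prodMk ((hp.sub ((hG.clm_apply hv).clm_apply hu)).prodMk (.sub (.neg ?_)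
    ((hG.clm_apply hv).clm_apply hp)))
  unfold curvatureMap
  exact (((((hDG.clm_apply hu).clm_apply hv).clm_apply hv).sub
    (((hDG.clm_apply hv).clm_apply hu).clm_apply hv)).add
    ((hG.clm_apply hu).clm_apply ((hG.clm_apply hv).clm_apply hv))).sub
    ((hG.clm_apply hv).clm_apply ((hG.clm_apply hu).clm_apply hv))

end JacobiSystem

section JacobiField

set_option linter.unusedSectionVars false

variable {E : Type*} [NormedAddCommGroup E] [NormedSpace ℝ E] [FiniteDimensional ℝ E]
  {M : Type*} [TopologicalSpace M] [ChartedSpace E M] [IsManifold 𝓘(ℝ, E) ∞ M]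
  {h : Metric E M} {c : ℝ → TangentBundle 𝓘(ℝ, E) M} {S : Set ℝ} {s : ℝ}
  {η η' : ∀ s, TangentSpace 𝓘(ℝ, E) (c s).1}

variable (h c S η) in
/-- A geodesic with its velocity, and a vector field along it with its covariant derivative, in the
preferred chart at `q`. -/
noncomputable def jacobiState (q : M) (t : ℝ) : (E × E) × (E × E) :=
  (tangentChart E q (c t),
    (vecCoord q (η t), vecCoord q (h.covDerivCurve (fun t ↦ (c t).1) S η t)))

/-- Jacobi fields along a geodesic solve the Jacobi system. -/
lemma Metric.IsJacobiFieldOn.hasDerivWithinAt_jacobiState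
    (hη : h.IsJacobiFieldOn (fun t ↦ (c t).1) η S) (hc : ∀ t ∈ S, h.IsSprayCurveAt c S t)
    (hS : UniqueDiffOn ℝ S) (hs : s ∈ S) {q : M} (hq : (c s).1 ∈ (extChartAt 𝓘(ℝ, E) q).source) :
    HasDerivWithinAt (jacobiState h c S η q)
      (jacobiSystem (h.christoffelAt q) (jacobiState h c S η q s)) S s := by
  have hbase : ∀ t ∈ S, ContinuousWithinAt (fun t ↦ (c t).1) S t := fun t ht ↦
    (hc t ht).continuousWithinAt_base
  let u : ℝ → E := fun t ↦ vecCoord q (η t)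
  have hu : ∀ t ∈ S, (c t).1 ∈ (extChartAt 𝓘(ℝ, E) q).source → ContDiffWithinAt ℝ 2 u S t := by
    intro t ht htq
    have h1 := mem_tangentChart_source.2
      (show (⟨(c t).1, η t⟩ : TangentBundle 𝓘(ℝ, E) M).1 ∈ (extChartAt 𝓘(ℝ, E) q).source from htq)
    rw [extChartAt_source] at h1
    have h2 := (contMDiffWithinAt_iff_target_of_mem_source
      (f := fun t ↦ (⟨(c t).1, η t⟩ : TangentBundle 𝓘(ℝ, E) M)) h1).1 (hη.contMDiffOn t ht)
    exact (contMDiffWithinAt_iff_contDiffWithinAt.1 h2.2).snd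
  have hp : ∀ t ∈ S, (c t).1 ∈ (extChartAt 𝓘(ℝ, E) q).source →
      vecCoord q (h.covDerivCurve (fun t ↦ (c t).1) S η t) = derivWithin u S t +
        h.christoffelAt q (extChartAt 𝓘(ℝ, E) q (c t).1) (vecCoord q (c t).2) (u t) :=
    fun t ht htq ↦ h.covDerivCurve_coord (hS t ht) (hbase t ht) htq
      ((hc t ht).hasDerivWithinAt_base htq)
      ((hu t ht htq).differentiableWithinAt (by norm_num)).hasDerivWithinAt
  -- Both covariant derivatives are now computed in the chart; the Jacobi equation then gives the
  -- derivative of the second component.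
  have hx := (hc s hs).hasDerivWithinAt_base hq
  have hv := (hc s hs).hasDerivWithinAt_vecCoord hq
  have hu' := ((hu s hs hq).differentiableWithinAt (by norm_num)).hasDerivWithinAt
  have hdu : DifferentiableWithinAt ℝ (derivWithin u S) S s :=
    (((hu s hs hq).fderivWithin_right (m := 1) hS (by norm_num) hs).differentiableWithinAt
      (by norm_num)).clm_apply (differentiableWithinAt_const 1)
  have hG := (h.differentiableAt_christoffelAt hq).hasFDerivAt.comp_hasDerivWithinAt s hx
  have hp' : HasDerivWithinAt
      (fun t ↦ vecCoord q (h.covDerivCurve (fun t ↦ (c t).1) S η t)) _ S s :=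
    (hdu.hasDerivWithinAt.add ((hG.clm_apply hv).clm_apply hu')).congr_of_eventuallyEq (by
      filter_upwards [self_mem_nhdsWithin, eventually_mem_source (hc s hs).1 hq] with t ht htq
      exact hp t ht htq) (hp s hs hq)
  have hpp := h.covDerivCurve_coord (hS s hs) (hbase s hs) hq hx hp'
  have hJ := congrArg (vecCoord q) (hη.jacobi_eq s hs)
  have hadd : ∀ a b : TangentSpace 𝓘(ℝ, E) (c s).1, vecCoord q (a + b) =
      vecCoord q a + vecCoord q b := fun a b ↦
    map_add (tangentCoordChange 𝓘(ℝ, E) (c s).1 q (c s).1) a b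
  have hzero : vecCoord q (0 : TangentSpace 𝓘(ℝ, E) (c s).1) = 0 :=
    map_zero (tangentCoordChange 𝓘(ℝ, E) (c s).1 q (c s).1)
  rw [hadd, hzero, h.vecCoord_curvature hq, (hc s hs).velocity_eq (hS s hs), hpp] at hJ
  refine (((hc s hs).2 q hq).prodMk (hu'.prodMk hp')).congr_deriv ?_
  refine Prod.ext rfl (Prod.ext ?_ ?_)
  · exact eq_sub_of_add_eq (hp s hs hq).symm
  · simp only [jacobiSystem, jacobiState]
    rw [← eq_sub_iff_add_eq, zero_sub, ← eq_sub_iff_add_eq] at hJ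
    exact hJ

/-- A Jacobi field along a geodesic is determined by its value and its covariant derivative at one
time. -/
theorem Metric.IsJacobiFieldOn.eqOn [S.OrdConnected]
    (hη : h.IsJacobiFieldOn (fun t ↦ (c t).1) η S) (hη' : h.IsJacobiFieldOn (fun t ↦ (c t).1) η' S)
    (hc : ∀ t ∈ S, h.IsSprayCurveAt c S t) (hS : UniqueDiffOn ℝ S) (hs : s ∈ S) (h0 : η s = η' s)
    (h1 : h.covDerivCurve (fun t ↦ (c t).1) S η s = h.covDerivCurve (fun t ↦ (c t).1) S η' s) :
    ∀ t ∈ S, η t = η' t := by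
  -- The set of times at which the two fields and their covariant derivatives agree is relatively
  -- open, by uniqueness for the Jacobi system, and relatively closed.
  intro t ht
  have hiff : ∀ q t, (c t).1 ∈ (extChartAt 𝓘(ℝ, E) q).source →
      (jacobiState h c S η q t = jacobiState h c S η' q t ↔ η t = η' t ∧
      h.covDerivCurve (fun t ↦ (c t).1) S η t = h.covDerivCurve (fun t ↦ (c t).1) S η' t) := by
    intro q t htq
    simp only [jacobiState, Prod.mk.injEq, (vecCoord_injective htq).eq_iff, true_and]
  refine ((IsPreconnected.induction₂ (s := S) (Set.OrdConnected.isPreconnected ‹_›)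
    (fun a b ↦ (η a = η' a ∧
      h.covDerivCurve (fun t ↦ (c t).1) S η a = h.covDerivCurve (fun t ↦ (c t).1) S η' a) ↔
      (η b = η' b ∧
      h.covDerivCurve (fun t ↦ (c t).1) S η b = h.covDerivCurve (fun t ↦ (c t).1) S η' b))
    (fun a ha ↦ ?_) (fun _ _ _ _ _ _ ↦ Iff.trans) (fun _ _ _ _ ↦ Iff.symm) hs ht).1 ⟨h0, h1⟩).1
  let q := (c a).1
  have hq : (c a).1 ∈ (extChartAt 𝓘(ℝ, E) q).source := mem_extChartAt_source _
  have hsrc := eventually_mem_source (hc a ha).1 hq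
  have hw := hη.hasDerivWithinAt_jacobiState hc hS ha hq
  have hw' := hη'.hasDerivWithinAt_jacobiState hc hS ha hq
  by_cases heq : jacobiState h c S η q a = jacobiState h c S η' q a
  · obtain ⟨K, D, hD, hLip⟩ := exists_lipschitzOnWith
      (((isOpen_extChartAt_target q).prod isOpen_univ).prod isOpen_univ)
      (contDiffOn_jacobiSystem (isOpen_extChartAt_target q) (h.contDiffOn_christoffelAt q))
      (w := jacobiState h c S η q a)
      ⟨⟨(extChartAt 𝓘(ℝ, E) q).map_source hq, mem_univ _⟩, mem_univ _⟩
    have hall : ∀ᶠ t in 𝓝[S] a, (c t).1 ∈ (extChartAt 𝓘(ℝ, E) q).source ∧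
        jacobiState h c S η q t ∈ D ∧ jacobiState h c S η' q t ∈ D :=
      hsrc.and ((hw.continuousWithinAt.eventually hD).and
        (hw'.continuousWithinAt.eventually (by simp only [← heq]; exact hD)))
    obtain ⟨ε, hε, hball⟩ := Metric.mem_nhdsWithin_iff.1 hall
    have hord : (Metric.ball a ε ∩ S).OrdConnected := by
      rw [Real.ball_eq_Ioo]
      exact ordConnected_Ioo.inter ‹_›
    have h1 := eqOn_of_hasDerivWithinAt (S := Metric.ball a ε ∩ S) (t₀ := a)
      (v := fun _ ↦ jacobiSystem (h.christoffelAt q)) (K := K) (D := D) (fun _ _ ↦ hLip)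
      (f := jacobiState h c S η q) (g := jacobiState h c S η' q)
      (fun t ht ↦ (hη.hasDerivWithinAt_jacobiState hc hS ht.2 (hball ht).1).mono inter_subset_right)
      (fun t ht ↦ (hball ht).2.1)
      (fun t ht ↦
        (hη'.hasDerivWithinAt_jacobiState hc hS ht.2 (hball ht).1).mono inter_subset_right)
      (fun t ht ↦ (hball ht).2.2) ⟨Metric.mem_ball_self hε, ha⟩ heq
    filter_upwards [inter_mem_nhdsWithin S (Metric.ball_mem_nhds a hε)] with t ht
    have ht' : t ∈ Metric.ball a ε ∩ S := ⟨ht.2, ht.1⟩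
    exact iff_of_true ((hiff q a hq).1 heq) ((hiff q t (hball ht').1).1 (h1 ht'))
  · have h3 := (hw.continuousWithinAt.prodMk hw'.continuousWithinAt).eventually
      (isClosed_diagonal.isOpen_compl.mem_nhds heq)
    filter_upwards [h3, hsrc] with t ht htq
    exact iff_of_false (fun H ↦ heq ((hiff q a hq).2 H)) fun H ↦ ht ((hiff q t htq).2 H)

end JacobiField

/-! ### The variation field is a Jacobi field -/

section VariationField

set_option linter.unusedSectionVars false

variable {E : Type*} [NormedAddCommGroup E] [NormedSpace ℝ E]
  {M : Type*} [TopologicalSpace M] [ChartedSpace E M] [IsManifold 𝓘(ℝ, E) ∞ M]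
  {E' : Type*} [NormedAddCommGroup E'] [NormedSpace ℝ E']
  {H' : Type*} [TopologicalSpace H'] {I' : ModelWithCorners ℝ E' H'}
  {N : Type*} [TopologicalSpace N] [ChartedSpace H' N]
  {x : N} {ξ : TangentSpace I' x}

lemma mdifferentiableAt_base {f : N → TangentBundle 𝓘(ℝ, E) M}
    (hf : MDifferentiableAt I' 𝓘(ℝ, E).tangent f x) :
    MDifferentiableAt I' 𝓘(ℝ, E) (fun y ↦ (f y).1) x :=
  ((mdifferentiableAt_totalSpace 𝓘(ℝ, E) f).1 hf).1

lemma vecCoord_mfderiv_base {f : N → TangentBundle 𝓘(ℝ, E) M}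
    (hf : MDifferentiableAt I' 𝓘(ℝ, E).tangent f x) {q : M}
    (hq : (f x).1 ∈ (extChartAt 𝓘(ℝ, E) q).source) :
    vecCoord q (mfderiv I' 𝓘(ℝ, E) (fun y ↦ (f y).1) x ξ) =
      (dirDeriv I' (fun y ↦ tangentChart E q (f y)) x ξ).1 := by
  rw [vecCoord_mfderiv (mdifferentiableAt_base hf) hq]
  exact dirDeriv_comp hasFDerivAt_fst (mdifferentiableAt_tangentChart hf hq)

/-- The covariant derivative of a vector field along a map in terms of the derivative of the map
into the tangent bundle that it defines. -/
lemma Metric.covDerivAlong_eq (h : Metric E M) {f : N → TangentBundle 𝓘(ℝ, E) M}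
    (hf : MDifferentiableAt I' 𝓘(ℝ, E).tangent f x) :
    h.covDerivAlong I' (fun y ↦ (f y).1) (fun y ↦ (f y).2) univ x ξ =
      ((dirDeriv I' (fun y ↦ tangentChart E (f x).1 (f y)) x ξ).2 +
        h.christoffelAt (f x).1 (tangentChart E (f x).1 (f x)).1
          (dirDeriv I' (fun y ↦ tangentChart E (f x).1 (f y)) x ξ).1
          (tangentChart E (f x).1 (f x)).2 : E) := by
  have hq := mem_extChartAt_source (I := 𝓘(ℝ, E)) (f x).1
  have h1 := vecCoord_mfderiv_base (ξ := ξ) hf hq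
  have h2 : dirDeriv I' (fun y ↦ vecCoord (f x).1 (f y).2) x ξ =
      (dirDeriv I' (fun y ↦ tangentChart E (f x).1 (f y)) x ξ).2 :=
    dirDeriv_comp hasFDerivAt_snd (mdifferentiableAt_tangentChart hf hq)
  rw [← h1, ← h2, ← h.christoffel_eq, vecCoord_self]
  simp only [Metric.covDerivAlong, mfderivWithin_univ, tangentChart_apply, vecCoord_self]
  rfl

lemma Metric.covDerivAlong_const_smul (h : Metric E M) {X : N → M}
    {φ : ∀ y, TangentSpace 𝓘(ℝ, E) (X y)} (a : ℝ)
    (hφ : MDifferentiableAt I' 𝓘(ℝ, E).tangent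
      (fun y ↦ (⟨X y, φ y⟩ : TangentBundle 𝓘(ℝ, E) M)) x) :
    MDifferentiableAt I' 𝓘(ℝ, E).tangent
      (fun y ↦ (⟨X y, a • φ y⟩ : TangentBundle 𝓘(ℝ, E) M)) x ∧
    h.covDerivAlong I' X (fun y ↦ a • φ y) univ x ξ = a • h.covDerivAlong I' X φ univ x ξ := by
  have hq := mem_extChartAt_source (I := 𝓘(ℝ, E)) (X x)
  let A : E × E →L[ℝ] E × E := (ContinuousLinearMap.id ℝ E).prodMap (a • ContinuousLinearMap.id ℝ E)
  have hd := mdifferentiableAt_tangentChart hφ hq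
  have hA : (fun y ↦ tangentChart E (X x) (⟨X y, a • φ y⟩ : TangentBundle 𝓘(ℝ, E) M)) =
      fun y ↦ A (tangentChart E (X x) (⟨X y, φ y⟩ : TangentBundle 𝓘(ℝ, E) M)) := by
    funext y
    exact Prod.ext rfl (map_smul (tangentCoordChange 𝓘(ℝ, E) (X y) (X x) (X y)) a (φ y))
  have hsm : MDifferentiableAt I' 𝓘(ℝ, E).tangent
      (fun y ↦ (⟨X y, a • φ y⟩ : TangentBundle 𝓘(ℝ, E) M)) x := by
    refine mdifferentiableAt_of_tangentChart (q := X x) ?_ ?_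
    · have h1 := eventually_mem_source
        ((continuousWithinAt_univ _ _).2 hφ.continuousAt) hq
      rwa [nhdsWithin_univ] at h1
    · rw [hA]
      exact A.hasFDerivAt.hasMFDerivAt.mdifferentiableAt.comp x hd
  refine ⟨hsm, ?_⟩
  have h1 := h.covDerivAlong_eq (ξ := ξ) hsm
  have h2 := h.covDerivAlong_eq (ξ := ξ) hφ
  have h3 : dirDeriv I' (fun y ↦ tangentChart E (X x)
      (⟨X y, a • φ y⟩ : TangentBundle 𝓘(ℝ, E) M)) x ξ =
      A (dirDeriv I' (fun y ↦ tangentChart E (X x)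
        (⟨X y, φ y⟩ : TangentBundle 𝓘(ℝ, E) M)) x ξ) := by
    rw [hA]
    exact dirDeriv_comp A.hasFDerivAt hd
  have h4 := congrFun hA x
  simp only [h3, h4] at h1
  refine h1.trans ?_
  rw [h2]
  simp only [A, ContinuousLinearMap.coe_prodMap', Prod.map_fst, Prod.map_snd, smul_apply,
    ContinuousLinearMap.coe_id', id_eq, map_smul]
  exact (smul_add a _ _).symm

variable [FiniteDimensional ℝ E] [T2Space M] {h : Metric E M}
  {c : N → ℝ → TangentBundle 𝓘(ℝ, E) M}

variable (I' c x ξ) in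
/-- The derivative at the parameter `x`, in the direction `ξ`, of a family of curves. -/
noncomputable def variationField (t : ℝ) : TangentSpace 𝓘(ℝ, E) (c x t).1 :=
  mfderiv I' 𝓘(ℝ, E) (fun y ↦ (c y t).1) x ξ

variable {S : Set ℝ} {t : ℝ} {q : M}

lemma Metric.eventually_mem_source_variation (hc : ∀ y t, h.IsSprayCurveAt (c y) univ t)
    (hq : (c x t).1 ∈ (extChartAt 𝓘(ℝ, E) q).source) :
    ∀ᶠ t in 𝓝 t, (c x t).1 ∈ (extChartAt 𝓘(ℝ, E) q).source := by
  have h1 := eventually_mem_source (hc x t).1 hq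
  rwa [nhdsWithin_univ] at h1

lemma Metric.vecCoord_covDerivCurve_variationField (hc : ∀ y t, h.IsSprayCurveAt (c y) univ t)
    (h0 : MDifferentiableAt I' 𝓘(ℝ, E).tangent (fun y ↦ c y 0) x) (hS : UniqueDiffWithinAt ℝ S t)
    (hq : (c x t).1 ∈ (extChartAt 𝓘(ℝ, E) q).source) :
    vecCoord q (h.covDerivCurve (fun t ↦ (c x t).1) S (variationField I' x ξ c) t) =
      (dirDeriv I' (fun y ↦ tangentChart E q (c y t)) x ξ).2 +
        h.christoffelAt q (tangentChart E q (c x t)).1 (tangentChart E q (c x t)).2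
          (dirDeriv I' (fun y ↦ tangentChart E q (c y t)) x ξ).1 := by
  have hcS := (hc x t).mono (subset_univ S)
  have hval : ∀ s, (c x s).1 ∈ (extChartAt 𝓘(ℝ, E) q).source →
      vecCoord q (variationField I' x ξ c s) =
        (dirDeriv I' (fun y ↦ tangentChart E q (c y s)) x ξ).1 := fun s hs ↦
    vecCoord_mfderiv_base (Metric.mdifferentiableAt_variation hc h0 s) hs
  have hζ := Metric.hasDerivAt_variation (ξ := ξ) hc h0 hq
  rw [fderiv_spray (h.differentiableAt_christoffelAt hq)] at hζ
  have hb : HasDerivWithinAt (fun t ↦ vecCoord q (variationField I' x ξ c t))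
      (dirDeriv I' (fun y ↦ tangentChart E q (c y t)) x ξ).2 S t := by
    refine (HasDerivAt.congr_of_eventuallyEq hζ.fst ?_).hasDerivWithinAt
    filter_upwards [Metric.eventually_mem_source_variation hc hq] with s hs using hval s hs
  have := h.covDerivCurve_coord hS hcS.continuousWithinAt_base hq (hcS.hasDerivWithinAt_base hq) hb
  rw [this, hval t hq]
  rfl

/-- The covariant derivative of the variation field of a family of geodesics is the covariant
derivative of the velocities in the direction of the variation: the Levi-Civita connection is
torsion-free. -/
lemma Metric.covDerivCurve_variationField (hc : ∀ y t, h.IsSprayCurveAt (c y) univ t)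
    (h0 : MDifferentiableAt I' 𝓘(ℝ, E).tangent (fun y ↦ c y 0) x)
    (hS : UniqueDiffWithinAt ℝ S t) :
    h.covDerivCurve (fun t ↦ (c x t).1) S (variationField I' x ξ c) t =
      h.covDerivAlong I' (fun y ↦ (c y t).1) (fun y ↦ (c y t).2) univ x ξ := by
  have hq := mem_extChartAt_source (I := 𝓘(ℝ, E)) (c x t).1
  have h1 := Metric.vecCoord_covDerivCurve_variationField (ξ := ξ) hc h0 hS hq
  have h2 := h.covDerivAlong_eq (ξ := ξ) (Metric.mdifferentiableAt_variation hc h0 t)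
  rw [vecCoord_self] at h1
  refine h1.trans (Eq.trans ?_ h2.symm)
  exact congrArg _ ((h.christoffelAt_symm hq).self_of_nhds _ _)

/-- The variation field solves the Jacobi system: this is the variational equation of the spray. -/
lemma Metric.hasDerivAt_variationState (hc : ∀ y t, h.IsSprayCurveAt (c y) univ t)
    (h0 : MDifferentiableAt I' 𝓘(ℝ, E).tangent (fun y ↦ c y 0) x)
    (hq : (c x t).1 ∈ (extChartAt 𝓘(ℝ, E) q).source) :
    HasDerivAt (jacobiState h (c x) univ (variationField I' x ξ c) q)
      (jacobiSystem (h.christoffelAt q)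
        (jacobiState h (c x) univ (variationField I' x ξ c) q t)) t := by
  let ζ : ℝ → E × E := fun t ↦ dirDeriv I' (fun y ↦ tangentChart E q (c y t)) x ξ
  let z : ℝ → E × E := fun t ↦ tangentChart E q (c x t)
  have hval : ∀ s, (c x s).1 ∈ (extChartAt 𝓘(ℝ, E) q).source →
      jacobiState h (c x) univ (variationField I' x ξ c) q s =
        (z s, ((ζ s).1, (ζ s).2 + h.christoffelAt q (z s).1 (z s).2 (ζ s).1)) := fun s hs ↦ by
    rw [jacobiState, Metric.vecCoord_covDerivCurve_variationField hc h0 uniqueDiffWithinAt_univ hs]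
    have h1 : vecCoord q (variationField I' x ξ c s) = (ζ s).1 :=
      vecCoord_mfderiv_base (Metric.mdifferentiableAt_variation hc h0 s) hs
    rw [h1]
  have hz : HasDerivAt z (spray (h.christoffelAt q) (z t)) t := by
    simpa only [hasDerivWithinAt_univ] using (hc x t).2 q hq
  have hζ : HasDerivAt ζ (fderiv ℝ (spray (h.christoffelAt q)) (z t) (ζ t)) t :=
    Metric.hasDerivAt_variation hc h0 hq
  have hp := hasDerivAt_of_variational (h.differentiableAt_christoffelAt hq)
    (h.christoffelAt_symm hq) hz hζ
  rw [fderiv_spray (h.differentiableAt_christoffelAt hq)] at hζ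
  have hu : HasDerivAt (fun s ↦ (ζ s).1) (ζ t).2 t := hζ.fst
  refine ((hz.prodMk (hu.prodMk hp)).congr_of_eventuallyEq ?_).congr_deriv ?_
  · filter_upwards [Metric.eventually_mem_source_variation hc hq] with s hs using hval s hs
  · rw [hval t hq]
    simp only [jacobiSystem, add_sub_cancel_right]

/-- The variation field of a family of geodesics is a Jacobi field. -/
theorem Metric.isJacobiFieldOn_variationField (hc : ∀ y t, h.IsSprayCurveAt (c y) univ t)
    (h0 : MDifferentiableAt I' 𝓘(ℝ, E).tangent (fun y ↦ c y 0) x) (hS : UniqueDiffOn ℝ S) :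
    h.IsJacobiFieldOn (fun t ↦ (c x t).1) (variationField I' x ξ c) S := by
  -- The covariant derivative within `S` is that within `ℝ`, for which the state is known.
  have hind : ∀ s ∈ S, h.covDerivCurve (fun t ↦ (c x t).1) S (variationField I' x ξ c) s =
      h.covDerivCurve (fun t ↦ (c x t).1) univ (variationField I' x ξ c) s := fun s hs ↦ by
    rw [Metric.covDerivCurve_variationField hc h0 (hS s hs),
      Metric.covDerivCurve_variationField hc h0 uniqueDiffWithinAt_univ]
  -- Smoothness: the state solves a differential equation with smooth right-hand side.
  refine ⟨fun s _ ↦ ContMDiffAt.contMDiffWithinAt ?_, fun s hs ↦ ?_⟩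
  · have := FiniteDimensional.complete ℝ E
    let q := (c x s).1
    have hq : (c x s).1 ∈ (extChartAt 𝓘(ℝ, E) q).source := mem_extChartAt_source _
    have h1 : ContDiffAt ℝ ∞ (jacobiState h (c x) univ (variationField I' x ξ c) q) s := by
      refine contDiffAt_of_hasDerivAt (contDiffOn_jacobiSystem (isOpen_extChartAt_target q)
        (h.contDiffOn_christoffelAt q)) ?_
      filter_upwards [Metric.eventually_mem_source_variation hc hq] with r hr
      exact ⟨⟨⟨(extChartAt 𝓘(ℝ, E) q).map_source hr, mem_univ _⟩, mem_univ _⟩,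
        Metric.hasDerivAt_variationState hc h0 hr⟩
    have h2 : ContDiffAt ℝ ∞ (fun t ↦ tangentChart E q
        (⟨(c x t).1, variationField I' x ξ c t⟩ : TangentBundle 𝓘(ℝ, E) M)) s :=
      h1.fst.fst.prodMk h1.snd.fst
    have hq' := mem_tangentChart_source.2 (show (⟨(c x s).1, variationField I' x ξ c s⟩ :
      TangentBundle 𝓘(ℝ, E) M).1 ∈ (extChartAt 𝓘(ℝ, E) q).source from hq)
    have hq'' := hq'
    rw [extChartAt_source] at hq''
    refine (contMDiffAt_iff_target_of_mem_source
      (f := fun t ↦ (⟨(c x t).1, variationField I' x ξ c t⟩ : TangentBundle 𝓘(ℝ, E) M)) hq'').2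
      ⟨?_, contMDiffAt_iff_contDiffAt.2 (h2.of_le (by norm_cast))⟩
    have h3 : ContinuousAt (tangentChart E q).symm (tangentChart E q
        (⟨(c x s).1, variationField I' x ξ c s⟩ : TangentBundle 𝓘(ℝ, E) M)) :=
      continuousAt_extChartAt_symm' hq'
    refine (h3.comp (f := fun t ↦ tangentChart E q (⟨(c x t).1, variationField I' x ξ c t⟩ :
      TangentBundle 𝓘(ℝ, E) M)) h2.continuousAt).congr ?_
    filter_upwards [Metric.eventually_mem_source_variation hc hq] with t ht
    exact (tangentChart E q).left_inv (mem_tangentChart_source.2 ht)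
  · have hq := mem_extChartAt_source (I := 𝓘(ℝ, E)) (c x s).1
    have hcS := (hc x s).mono (subset_univ S)
    have hp : HasDerivAt (fun t ↦ vecCoord (c x s).1
        (h.covDerivCurve (fun t ↦ (c x t).1) univ (variationField I' x ξ c) t))
        (jacobiSystem (h.christoffelAt (c x s).1)
          (jacobiState h (c x) univ (variationField I' x ξ c) (c x s).1 s)).2.2 s :=
      (Metric.hasDerivAt_variationState (ξ := ξ) hc h0 hq).snd.snd
    have hp' := (hp.hasDerivWithinAt (s := S)).congr (f₁ := fun t ↦ vecCoord (c x s).1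
      (h.covDerivCurve (fun t ↦ (c x t).1) S (variationField I' x ξ c) t))
      (fun t ht ↦ by rw [hind t ht]) (by rw [hind s hs])
    have hpp := h.covDerivCurve_coord (hS s hs) hcS.continuousWithinAt_base hq
      (hcS.hasDerivWithinAt_base hq) hp'
    have hcurv := h.vecCoord_curvature hq (variationField I' x ξ c s) (c x s).2 (c x s).2
    have hvel := hcS.velocity_eq (hS s hs)
    rw [hvel]
    refine vecCoord_injective hq ?_
    have hadd : ∀ a b : TangentSpace 𝓘(ℝ, E) (c x s).1, vecCoord (c x s).1 (a + b) =
        vecCoord (c x s).1 a + vecCoord (c x s).1 b := fun a b ↦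
      map_add (tangentCoordChange 𝓘(ℝ, E) (c x s).1 (c x s).1 (c x s).1) a b
    have hzero : vecCoord (c x s).1 (0 : TangentSpace 𝓘(ℝ, E) (c x s).1) = 0 :=
      map_zero (tangentCoordChange 𝓘(ℝ, E) (c x s).1 (c x s).1 (c x s).1)
    rw [hadd, hzero, hpp, hcurv, hind s hs]
    simp only [jacobiSystem, jacobiState, tangentChart_apply]
    abel

end VariationField

/-! ### The differential of the deformed map -/

section InitialConditions

variable {E : Type*} [NormedAddCommGroup E] [NormedSpace ℝ E]
  {M : Type*} [TopologicalSpace M] [ChartedSpace E M] [IsManifold 𝓘(ℝ, E) ∞ M]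
  {E' : Type*} [NormedAddCommGroup E'] [NormedSpace ℝ E']
  {H' : Type*} [TopologicalSpace H'] {I' : ModelWithCorners ℝ E' H'}
  {N : Type*} [TopologicalSpace N] [ChartedSpace H' N]

/-- The derivative and the covariant derivative of a map into the tangent bundle depend only on the
map; the values are compared in the tangent bundle, since base points agree only propositionally. -/
lemma mk_mfderiv_congr {f : N → TangentBundle 𝓘(ℝ, E) M} (h : Metric E M) {X : N → M}
    {V : ∀ y, TangentSpace 𝓘(ℝ, E) (X y)} (hf : f = fun y ↦ ⟨X y, V y⟩) (x : N)
    (ξ : TangentSpace I' x) :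
    (⟨(f x).1, mfderiv I' 𝓘(ℝ, E) (fun y ↦ (f y).1) x ξ⟩ : TangentBundle 𝓘(ℝ, E) M) =
        ⟨X x, mfderiv I' 𝓘(ℝ, E) X x ξ⟩ ∧
      (⟨(f x).1, h.covDerivAlong I' (fun y ↦ (f y).1) (fun y ↦ (f y).2) univ x ξ⟩ :
        TangentBundle 𝓘(ℝ, E) M) = ⟨X x, h.covDerivAlong I' X V univ x ξ⟩ := by
  subst hf
  exact ⟨rfl, rfl⟩

end InitialConditions

end PseudoRiem

/-- Let `(M, h)` be a geodesically complete pseudo-Riemannian manifold, `X : N → M` a smooth map (in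
particular, the embedding of a submanifold), `φ` a smooth section of `X^* TM`, and
`X̃(x) = exp_{X(x)}(λ φ(x))`. For `ξ ∈ T_xN`, the curve `α(s) = exp_{X(x)}(s λ φ(x))` is a geodesic
on `[0, 1]` with initial velocity `λ φ(x)`, there is exactly one Jacobi field `η` along `α` on
`[0, 1]` with `η(0) = dX(x)(ξ)` and `∇_s η(0) = λ ∇_ξ φ(x)`, the map `X̃` is differentiable at `x`,
and `dX̃(x)(ξ) = η(1)`. -/
theorem mainTheorem2
    {E : Type*} [NormedAddCommGroup E] [NormedSpace ℝ E] [FiniteDimensional ℝ E]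
    {M : Type*} [TopologicalSpace M] [T2Space M] [ChartedSpace E M] [IsManifold 𝓘(ℝ, E) ∞ M]
    (h : PseudoRiem.Metric E M) (hcomplete : h.IsGeodesicallyComplete)
    {E' : Type*} [NormedAddCommGroup E'] [NormedSpace ℝ E']
    {H' : Type*} [TopologicalSpace H'] (I' : ModelWithCorners ℝ E' H')
    {N : Type*} [TopologicalSpace N] [ChartedSpace H' N] [IsManifold I' ∞ N]
    (X : N → M) (hX : ContMDiff I' 𝓘(ℝ, E) ∞ X)
    (φ : ∀ x, TangentSpace 𝓘(ℝ, E) (X x))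
    (hφ : ContMDiff I' 𝓘(ℝ, E).tangent ∞ (fun x ↦ (⟨X x, φ x⟩ : TangentBundle 𝓘(ℝ, E) M)))
    (lam : ℝ) (x : N) (ξ : TangentSpace I' x) :
    let X' : N → M := h.deform X φ lam
    let α : ℝ → M := fun s ↦ h.exp (X x) (s • lam • φ x)
    h.IsGeodesicOn α (Icc 0 1) ∧
    (⟨α 0, PseudoRiem.velocity α (Icc 0 1) 0⟩ : TangentBundle 𝓘(ℝ, E) M) = ⟨X x, lam • φ x⟩ ∧
    MDifferentiableAt I' 𝓘(ℝ, E) X' x ∧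
    ∃ η : ∀ s, TangentSpace 𝓘(ℝ, E) (α s),
      h.IsJacobiFieldWithInit α η (X x)
        (mfderiv I' 𝓘(ℝ, E) X x ξ) (lam • h.covDerivAlong I' X φ univ x ξ) ∧
      (∀ η' : ∀ s, TangentSpace 𝓘(ℝ, E) (α s),
        h.IsJacobiFieldWithInit α η' (X x)
          (mfderiv I' 𝓘(ℝ, E) X x ξ) (lam • h.covDerivAlong I' X φ univ x ξ) →
        ∀ s ∈ Icc (0 : ℝ) 1, η' s = η s) ∧
      (⟨X' x, mfderiv I' 𝓘(ℝ, E) X' x ξ⟩ : TangentBundle 𝓘(ℝ, E) M) = ⟨α 1, η 1⟩ := by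
  intro X' α
  -- The variation through geodesics `c y t = (γ_y(t), γ_y'(t))` with `γ_y'(0) = λ φ(y)`.
  choose γ hγ hγ0 using fun y ↦ hcomplete ⟨X y, lam • φ y⟩
  let c : N → ℝ → TangentBundle 𝓘(ℝ, E) M := fun y t ↦ ⟨γ y t, PseudoRiem.velocity (γ y) univ t⟩
  have hc : ∀ y t, h.IsSprayCurveAt (c y) univ t := fun y t ↦
    (hγ y).isSprayCurveAt uniqueDiffOn_univ (mem_univ t)
  have hc0 : (fun y ↦ c y 0) = fun y ↦ ⟨X y, lam • φ y⟩ := funext hγ0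
  have hsm : ∀ y, ContMDiff 𝓘(ℝ, ℝ) 𝓘(ℝ, E) ∞ (fun t ↦ (c y t).1) := fun y ↦
    contMDiffOn_univ.1 (hγ y).contMDiffOn
  have hexp : ∀ y a, h.exp (X y) (a • lam • φ y) = (c y a).1 := by
    intro y a
    have h1 := PseudoRiem.Metric.exp_smul_eq (hsm y) (hc y) a
    have h2 : c y 0 = ⟨X y, lam • φ y⟩ := hγ0 y
    rwa [h2] at h1
  have hα : α = fun t ↦ (c x t).1 := funext (hexp x)
  have hX' : X' = fun y ↦ (c y 1).1 := funext fun y ↦ by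
    rw [← hexp y 1, one_smul]
    rfl
  obtain ⟨hd, hcov⟩ := h.covDerivAlong_const_smul (x := x) (ξ := ξ) lam
    (hφ.mdifferentiableAt (by simp))
  have h0 : MDifferentiableAt I' 𝓘(ℝ, E).tangent (fun y ↦ c y 0) x := by
    rw [hc0]
    exact hd
  have hS : UniqueDiffOn ℝ (Icc (0 : ℝ) 1) := uniqueDiffOn_Icc zero_lt_one
  have hz : (0 : ℝ) ∈ Icc (0 : ℝ) 1 := left_mem_Icc.2 zero_le_one
  have hcS : ∀ y, ∀ t ∈ Icc (0 : ℝ) 1, h.IsSprayCurveAt (c y) (Icc 0 1) t := fun y t _ ↦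
    (hc y t).mono (subset_univ _)
  obtain ⟨hi, hi'⟩ := PseudoRiem.mk_mfderiv_congr h hc0 x ξ
  rw [hcov] at hi'
  -- `α` and `X'` are replaced by the base curves, so that the types of `η` and `c` match.
  clear_value X' α c
  subst hα hX'
  refine ⟨h.isGeodesicOn_of_isSprayCurveAt hS (hsm x).contMDiffOn (hcS x), ?_,
    PseudoRiem.mdifferentiableAt_base (PseudoRiem.Metric.mdifferentiableAt_variation hc h0 1),
    PseudoRiem.variationField I' x ξ c, ?_, ?_, rfl⟩
  · rw [(hcS x 0 hz).velocity_eq (hS 0 hz)]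
    exact congrFun hc0 x
  · refine ⟨PseudoRiem.Metric.isJacobiFieldOn_variationField hc h0 hS, hi, ?_⟩
    rw [PseudoRiem.Metric.covDerivCurve_variationField hc h0 (hS 0 hz)]
    exact hi'
  · intro η' hη'
    have hi2 := hη'.init.trans hi.symm
    have hi3 := hη'.init_deriv.trans hi'.symm
    refine PseudoRiem.Metric.IsJacobiFieldOn.eqOn hη'.isJacobi
      (PseudoRiem.Metric.isJacobiFieldOn_variationField hc h0 hS) (hcS x) hS hz ?_ ?_
    · exact TotalSpace.mk_injective _ hi2
    · rw [PseudoRiem.Metric.covDerivCurve_variationField hc h0 (hS 0 hz)]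
      exact TotalSpace.mk_injective _ hi3
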